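/- **Setting.** For $d\ge 1$ let $D=D[d]=\prod_{i=1}^d\Delta_i$ on $\ell^2(\mathbb Z^d)$, where $\Delta_i=\frac12(S_i+S_i^{-1})$ and $(S_i^{k}u)(n)=u(n_1,\dots,n_i-k,\dots,n_d)$; let $N_i$ be multiplication by $n_i$. For an integer $\kappa\ge1$ and $j\ge 1$ put, on compactly supported sequences, $$A_{j\kappa}=\sum_{i=1}^d\frac1{4\mathrm i}\big[(S_i^{j\kappa}-S_i^{-j\kappa})N_i+N_i(S_i^{j\kappa}-S_i^{-j\kappa})\big].$$ Let $\mu_\kappa(D)$ be the set of $E\in\sigma(D)$ for which there are a self-adjoint linear combination (finite or infinite, with real coefficients) $\mathbb A=\sum_{j\ge1}\rho_{j\kappa}A_{j\kappa}$, an open interval $I\ni E$ and $\gamma>0$ with $1_I(D)[D,\mathrm i\mathbb A]_\circ1_I(D)\ge\gamma 1_I(D)$, where $[D,\mathrm i\mathbb A]_\circ$ is the bounded extension of the commutator from the compactly supported sequences; let $\Theta_\kappa(D)=\sigma(D)\setminus\mu_\kappa(D)$. Let $T_n$, $U_n$ be the Chebyshev polynomials of the first and second kind and $$g_{j\kappa}(x)=\sum_{i=1}^d\Big(\prod_{l\ne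 i}x_l\Big)(1-x_i^2)\,U_{j\kappa-1}(x_i),\qquad S_E=\Big\{x\in[-1,1]^d:\prod_l x_l=E\Big\}.$$ For $m\ge0$ let $\Theta_{m,\kappa}(D)$ be the set of $E$ for which there are $x_0,\dots,x_m\in S_E$ and $\omega_0,\dots,\omega_{m-1}\le0$ with $g_{j\kappa}(x_m)=\sum_{q<m}\omega_q\,g_{j\kappa}(x_q)$ for all $j\ge1$, and let $\theta_{0,\kappa}(D)=\{\prod_{q=1}^d\cos(j_q\pi/\kappa):0\le j_q\le\kappa\}$. **Theorem.** Let $\kappa=4$. 1. In dimension $3$: $(\cos(\pi/4),1)\subset\mu_4(D)$. 2. In dimension $3$: $0,\ \cos^3(\pi/4),\ \cos^2(\pi/4),\ \cos(\pi/4),\ 1\in\theta_{0,4}(D)$, and $\theta_{0,4}(D)\subset\Theta_{0,4}(D)$. 3. (The sequence.) For every $n\ge1$ there is exactly one $\mathcal E_n\in(\cos^2(\pi/4),\cos(\pi/4))$ for which there are reals $\mathcal E_n=X_0<X_1<\dots<X_{n+1}=1$ with $T_4(X_q)=T_4(X_{n-q})$ for $0\le q<n/2$, $X_{n+1-q}=\mathcal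 E_n/X_q$ for $0\le q\le(n+1)/2$, and $X_{(n-1)/2}<\cos(\pi/4)<X_{(n+1)/2}$ if $n$ is odd, $X_{n/2}=\cos(\pi/4)$ if $n$ is even. Put $\mathcal E_0=\cos(\pi/4)$. In dimension $2$, $\mathcal E_n\in\Theta_4(D)$ for all $n\ge0$, and $\mathcal E_{2n-1},\mathcal E_{2n}\in\Theta_{n,4}(D)$ for all $n\ge1$. 4. In dimension $3$: $\mathcal E_n\in\Theta_4(D)$ for all $n\ge0$, $\mathcal E_n\in(\cos^2(\pi/4),\cos(\pi/4))$ for all $n\ge1$, and $(\mathcal E_n)_{n\ge0}$ is strictly decreasing with limit $\cos^2(\pi/4)$. 5. In dimension $3$: $\mathcal E_n\cos(\pi/4)\in\Theta_4(D)$ for all $n\ge0$, $\mathcal E_n\cos(\pi/4)\in(\cos^3(\pi/4),\cos^2(\pi/4))$ for all $n\ge1$, and $(\mathcal E_n\cos(\pi/4))_{n\ge0}$ is strictly decreasing with limit $\cos^3(\pi/4)$. -/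

import Mathlib

open Real Set Filter Topology
open scoped InnerProductSpace

noncomputable section

namespace MV

/-! ### The Hilbert space and the Laplacian -/

/-- The Hilbert space `ℓ²(ℤ^d)`. -/
abbrev H (d : ℕ) : Type := lp (fun _ : Fin d → ℤ => ℂ) 2

/-- Square-summability is invariant under translations of the lattice. -/
theorem memlp_shift {d : ℕ} (v : Fin d → ℤ) (u : H d) :
    Memℓp (fun n : Fin d → ℤ => (u : (Fin d → ℤ) → ℂ) (n - v)) 2 := by
  refine memℓp_gen ?_
  have h := (lp.memℓp u).summable (by norm_num)
  exact h.comp_injective (sub_left_injective (b := v))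

/-- Translation of sequences by the lattice vector `v`. -/
def translate {d : ℕ} (v : Fin d → ℤ) : H d →ₗᵢ[ℂ] H d where
  toFun u := ⟨fun n => (u : (Fin d → ℤ) → ℂ) (n - v), memlp_shift v u⟩
  map_add' _ _ := rfl
  map_smul' _ _ := rfl
  norm_map' u := by
    have h2 : 0 < (2 : ENNReal).toReal := by norm_num
    rw [lp.norm_eq_tsum_rpow h2, lp.norm_eq_tsum_rpow h2]
    congr 1
    exact (Equiv.subRight v).tsum_eq
      (fun n => ‖(u : (Fin d → ℤ) → ℂ) n‖ ^ (2 : ENNReal).toReal)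

/-- `S_i ^ k`, the shift by `k` units in the `i`-th coordinate:
`(S_i ^ k u)(n) = u(n_1, …, n_i - k, …, n_d)`. -/
def shift {d : ℕ} (i : Fin d) (k : ℤ) : H d →ₗᵢ[ℂ] H d := translate (Pi.single i k)

/-- `Δ_i = (S_i + S_i⁻¹) / 2`. -/
def laplacianCoord {d : ℕ} (i : Fin d) : H d →L[ℂ] H d :=
  (2⁻¹ : ℂ) • ((shift i 1).toContinuousLinearMap + (shift i (-1)).toContinuousLinearMap)

/-- The Molchanov–Vainberg Laplacian `D = Δ_1 Δ_2 ⋯ Δ_d` on `ℓ²(ℤ^d)`. -/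
def laplacian (d : ℕ) : H d →L[ℂ] H d :=
  (List.ofFn fun i : Fin d => laplacianCoord i).prod

/-! ### The conjugate operators -/

/-- The compactly supported sequences. -/
def finSupp (d : ℕ) : Submodule ℂ (H d) where
  carrier := {u | (Function.support (u : (Fin d → ℤ) → ℂ)).Finite}
  zero_mem' := by
    have : Function.support ((0 : H d) : (Fin d → ℤ) → ℂ) = ∅ := Function.support_zero
    simp only [Set.mem_ofPred_eq, this, Set.finite_empty]
  add_mem' {u v} hu hv := by
    refine (hu.union hv).subset ?_
    rw [lp.coeFn_add]
    exact Function.support_add _ _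
  smul_mem' c u hu := by
    refine Set.Finite.subset hu ?_
    rw [lp.coeFn_smul]
    exact Function.support_const_smul_subset c _

/-- The position operator `N_i` on arbitrary functions on the lattice. -/
def posFun {d : ℕ} (i : Fin d) (f : (Fin d → ℤ) → ℂ) : (Fin d → ℤ) → ℂ :=
  fun n => (n i : ℂ) * f n

/-- `S_i ^ k - S_i ^ (-k)` on arbitrary functions on the lattice. -/
def diffFun {d : ℕ} (i : Fin d) (k : ℤ) (f : (Fin d → ℤ) → ℂ) : (Fin d → ℤ) → ℂ :=
  fun n => f (n - Pi.single i k) - f (n + Pi.single i k)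

/-- `(1 / 4i) ∑_i [(S_i ^ k - S_i ^ (-k)) N_i + N_i (S_i ^ k - S_i ^ (-k))]` on arbitrary functions
on the lattice. -/
def genFun {d : ℕ} (k : ℤ) (f : (Fin d → ℤ) → ℂ) : (Fin d → ℤ) → ℂ :=
  fun n => (1 / (4 * Complex.I)) *
    ∑ i : Fin d, (diffFun i k (posFun i f) n + posFun i (diffFun i k f) n)

theorem genFun_finite {d : ℕ} (k : ℤ) (f : (Fin d → ℤ) → ℂ) (hf : (Function.support f).Finite) :
    (Function.support (genFun k f)).Finite := by
  have hfin : (⋃ i : Fin d, ((fun n => n - (Pi.single i k : Fin d → ℤ)) ⁻¹' Function.support f ∪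
      (fun n => n + (Pi.single i k : Fin d → ℤ)) ⁻¹' Function.support f)).Finite := by
    refine Set.finite_iUnion fun i => Set.Finite.union ?_ ?_
    · exact hf.preimage (sub_left_injective.injOn)
    · exact hf.preimage (add_left_injective _).injOn
  refine hfin.subset fun n hn => ?_
  by_contra hcon
  simp only [Set.mem_iUnion, Set.mem_union, Set.mem_preimage, Function.mem_support, not_exists,
    not_or, not_not] at hcon
  refine hn ?_
  have : ∀ i : Fin d, diffFun i k (posFun i f) n + posFun i (diffFun i k f) n = 0 := fun i => by
    simp [diffFun, posFun, (hcon i).1, (hcon i).2]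
  simp [genFun, this]

theorem memlp_of_finite {d : ℕ} {f : (Fin d → ℤ) → ℂ} (hf : (Function.support f).Finite) :
    Memℓp f 2 :=
  Memℓp.of_exponent_ge (memℓp_zero hf) zero_le

/-- The generator of dilations `A_k = ∑_i (1 / 4i) [(S_i ^ k - S_i ^ (-k)) N_i +
N_i (S_i ^ k - S_i ^ (-k))]` of frequency `k` on the compactly supported sequences. -/
def gen (d : ℕ) (k : ℤ) : finSupp d →ₗ[ℂ] H d where
  toFun u := ⟨genFun k ((u : H d) : (Fin d → ℤ) → ℂ), memlp_of_finite (genFun_finite k _ u.2)⟩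
  map_add' u v := by
    ext n
    simp only [genFun, diffFun, posFun, Submodule.coe_add, lp.coeFn_add, Pi.add_apply]
    rw [← mul_add, ← Finset.sum_add_distrib]
    congr 1
    exact Finset.sum_congr rfl fun i _ => by ring
  map_smul' c u := by
    ext n
    simp only [genFun, diffFun, posFun, Submodule.coe_smul, lp.coeFn_smul, Pi.smul_apply,
      smul_eq_mul, RingHom.id_apply]
    rw [mul_left_comm, Finset.mul_sum Finset.univ _ c]
    congr 1
    exact Finset.sum_congr rfl fun i _ => by ring

/-- `A` is a self-adjoint linear combination, finite or infinite, `∑_{j ≥ 1} ρ_j A_{jκ}` with real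
coefficients: a self-adjoint operator whose domain contains the compactly supported sequences and
which acts on them as this series, convergent in `ℓ²(ℤ^d)`.
(For a finite combination this is the closure of its restriction to those sequences.) -/
def IsConjugate (d κ : ℕ) (A : H d →ₗ.[ℂ] H d) : Prop :=
  IsSelfAdjoint A ∧ ∃ ρ : ℕ → ℝ, ∀ u : finSupp d, ∃ hu : (u : H d) ∈ A.domain,
    HasSum (fun j : ℕ => (ρ (j + 1) : ℂ) • gen d (((j + 1) * κ : ℕ) : ℤ) u) (A ⟨u, hu⟩)

/-- The bounded operator `B` is the extension `[T, iA]_∘` of the commutator `T(iA) - (iA)T`, which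
is computed, in the sense of forms, against the compactly supported sequences. -/
def IsCommutator {d : ℕ} (T : H d →L[ℂ] H d) (A : H d →ₗ.[ℂ] H d) (B : H d →L[ℂ] H d) : Prop :=
  ∀ u v : A.domain, (u : H d) ∈ finSupp d → (v : H d) ∈ finSupp d →
    ⟪(v : H d), B u⟫_ℂ = Complex.I * (⟪T v, A u⟫_ℂ - ⟪A v, T u⟫_ℂ)

/-! ### The Mourre estimate and thresholds -/

section Spectral

variable {K : Type*} [NormedAddCommGroup K] [InnerProductSpace ℂ K] [CompleteSpace K]

/-- The span of the ranges of `f(T)` (continuous functional calculus), where `f` runs through the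
continuous functions that vanish outside the open set `I`. -/
def spectralCore (T : K →L[ℂ] K) (I : Set ℝ) : Submodule ℂ K :=
  ⨆ f : {f : C(ℝ, ℝ) // ∀ x ∉ I, f x = 0}, LinearMap.range (cfc (fun t => f.1 t) T).toLinearMap

/-- The spectral projection `1_I(T)` of a bounded self-adjoint operator `T`, for an open set `I`:
the strong limit of `f_n(T)` for continuous `f_n ↑ 1_I`, that is the orthogonal projection onto the
closed span of the ranges of `f(T)`, `f` continuous and zero outside `I`. -/
def spectralProj (T : K →L[ℂ] K) (I : Set ℝ) : K →L[ℂ] K :=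
  (spectralCore T I).topologicalClosure.starProjection

end Spectral

/-- The strict Mourre estimate `1_I(D) [D, iA]_∘ 1_I(D) ≥ γ 1_I(D)`. -/
def MourreEstimate {d : ℕ} (A : H d →ₗ.[ℂ] H d) (I : Set ℝ) (γ : ℝ) : Prop :=
  ∃ B : H d →L[ℂ] H d, IsCommutator (laplacian d) A B ∧
    γ • spectralProj (laplacian d) I ≤
      spectralProj (laplacian d) I * B * spectralProj (laplacian d) I

/-- `μ_κ(D)`: the energies of the spectrum of `D` around which a strict Mourre estimate holds for
some self-adjoint linear combination of the `A_{jκ}`. -/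
def mu (d κ : ℕ) : Set ℝ :=
  {E | E ∈ spectrum ℝ (laplacian d) ∧ ∃ A : H d →ₗ.[ℂ] H d, IsConjugate d κ A ∧
    ∃ a b γ : ℝ, E ∈ Ioo a b ∧ 0 < γ ∧ MourreEstimate A (Ioo a b) γ}

/-- `Θ_κ(D)`: the thresholds, that is the energies of the spectrum of `D` outside `μ_κ(D)`. -/
def Theta (d κ : ℕ) : Set ℝ := spectrum ℝ (laplacian d) \ mu d κ

/-- `g_k(x) = ∑_i (∏_{l ≠ i} x_l) (1 - x_i²) U_{k-1}(x_i)`. -/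
def g {d : ℕ} (k : ℕ) (x : Fin d → ℝ) : ℝ :=
  ∑ i : Fin d, (∏ l ∈ Finset.univ.erase i, x l) * (1 - x i ^ 2) *
    (Polynomial.Chebyshev.U ℝ ((k : ℤ) - 1)).eval (x i)

/-- The constant energy surface `S_E = {x ∈ [-1,1]^d : x_1 ⋯ x_d = E}`. -/
def energySurface (d : ℕ) (E : ℝ) : Set (Fin d → ℝ) :=
  {x | (∀ l, x l ∈ Icc (-1 : ℝ) 1) ∧ ∏ l, x l = E}

/-- `Θ_{m,κ}(D)`: there are points `x_0, …, x_m` of `S_E` and reals `ω_0, …, ω_{m-1} ≤ 0` such that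
`g_{jκ}(x_m) = ∑_{q < m} ω_q g_{jκ}(x_q)` for all `j ≥ 1`. -/
def ThetaM (d m κ : ℕ) : Set ℝ :=
  {E | ∃ x : ℕ → Fin d → ℝ, ∃ ω : ℕ → ℝ, (∀ q ≤ m, x q ∈ energySurface d E) ∧
    (∀ q < m, ω q ≤ 0) ∧
    ∀ j : ℕ, 1 ≤ j → g (j * κ) (x m) = ∑ q ∈ Finset.range m, ω q * g (j * κ) (x q)}

/-- `θ_{0,κ}(D)`: the products `∏_q cos(j_q π / κ)`, `0 ≤ j_q ≤ κ`. -/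
def theta0 (d κ : ℕ) : Set ℝ :=
  {E | ∃ J : Fin d → ℕ, (∀ q, J q ≤ κ) ∧ E = ∏ q, cos (J q * π / κ)}

/-! ### The two-dimensional sequence of thresholds -/

/-- `E` is an energy of `J_2(κ) = (cos² (π/κ), cos (π/κ))` for which the system defining the `n`-th
term `𝓔_n(κ)` of the two-dimensional sequence has a solution
`E = X_0 < X_1 < ⋯ < X_{n+1} = 1`. -/
def IsEnergy (κ n : ℕ) (E : ℝ) : Prop :=
  E ∈ Ioo (cos (π / κ) ^ 2) (cos (π / κ)) ∧ ∃ X : ℕ → ℝ,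
    (∀ q, 2 * q < n →
      (Polynomial.Chebyshev.T ℝ κ).eval (X q) = (Polynomial.Chebyshev.T ℝ κ).eval (X (n - q))) ∧
    (∀ q, 2 * q ≤ n + 1 → X (n + 1 - q) = E / X q) ∧
    X 0 = E ∧ X (n + 1) = 1 ∧ (∀ q ≤ n, X q < X (q + 1)) ∧
    (Odd n → X ((n - 1) / 2) < cos (π / κ) ∧ cos (π / κ) < X ((n + 1) / 2)) ∧
    (Even n → X (n / 2) = cos (π / κ))

/-- `𝓔` is the two-dimensional sequence: `𝓔_0 = cos (π/κ)` and, for `n ≥ 1`, `𝓔_n` is the unique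
energy of `J_2(κ)` solving the `n`-th system. -/
def IsEnergySeq (κ : ℕ) (E : ℕ → ℝ) : Prop :=
  E 0 = cos (π / κ) ∧ ∀ n, 1 ≤ n → ∀ e : ℝ, IsEnergy κ n e ↔ e = E n

end MV

end

/-! In Fourier variables `laplacian d` is multiplication by x_1 ⋯ x_d with x_i = cos ξ_i, and its
commutator with i A_k is bounded with symbol `g k x`.

Thresholds. Wave packets of quasi-momentum ξ turn a strict Mourre estimate near E into the pointwise
bound G = ∑ ρ_j g_{jκ} ≥ γ on the whole of S_E (`le_tsum_of_mourreEstimate`). A relation g(x_m) = ∑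
ω_q g(x_q) with ω_q ≤ 0 would force G(x_m) ≤ 0; hence `thetaM_subset_theta`.

The sequence. For positive x ≠ y, T_4(x) = T_4(y) means x² + y² = 1. With Y_q = X_q² the n-th system
becomes Y_q + Y_{n-q} = 1 and Y_q Y_{n+1-q} = E², so Y_{q+1} = E² / (1 - Y_q). This Möbius recursion
is solved by Y_q = E sin((q+1)φ) / sin((q+2)φ) with 2 E cos φ = 1. The end condition Y_{n+1} = 1
becomes sin((n+4)φ) = 0, and positivity leaves only φ = π/(n+4), so 𝓔_n = 1 / (2 cos(π/(n+4))).
Monotonicity and the limit can be read off.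

Along the chain, the values of g at (X_q, X_{n+1-q}) split into two terms. Reflection in the circle
x² + y² = 1 makes neighbouring terms proportional with negative ratio, so a positively weighted sum
telescopes (`mem_thetaM_two_of_chain`). A third coordinate cos(pπ/4) only rescales g, which carries
the relations to dimension 3.

Mourre estimate. Above cos(π/4) in dimension 3 the single generator A_4 suffices: the symbol of the
commutator is 4D ∑ (1 - x_i²)(2x_i² - 1), and x_i² ≥ D² > 1/2. The bound is an algebraic identity
between commuting operators (`mourre_of_commuting`). -/

namespace MV

variable {d : ℕ}

/-! ### The algebra of translations -/

/-- Translation by `v` as a bounded operator. -/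
noncomputable def trans (v : Fin d → ℤ) : H d →L[ℂ] H d := (translate v).toContinuousLinearMap

theorem trans_apply (v : Fin d → ℤ) (u : H d) (n : Fin d → ℤ) : trans v u n = u (n - v) := rfl

theorem trans_zero : trans (0 : Fin d → ℤ) = 1 := by
  ext u n
  simp [trans_apply]

theorem trans_add (v w : Fin d → ℤ) : trans (v + w) = trans v * trans w := by
  ext u n
  simp [trans_apply, sub_sub]

theorem norm_trans_apply (v : Fin d → ℤ) (u : H d) : ‖trans v u‖ = ‖u‖ :=
  (translate v).norm_map u

theorem norm_trans_le (v : Fin d → ℤ) : ‖trans v‖ ≤ 1 :=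
  (trans v).opNorm_le_bound zero_le_one fun u => by rw [norm_trans_apply, one_mul]

theorem star_trans (v : Fin d → ℤ) : star (trans v) = trans (-v) := by
  rw [ContinuousLinearMap.star_eq_adjoint, eq_comm, ContinuousLinearMap.eq_adjoint_iff]
  intro u w
  have h : trans v (trans (-v) u) = u := by
    rw [← mul_apply_eq_comp, ← trans_add, add_neg_cancel, trans_zero]
    rfl
  conv_rhs => rw [← h]
  exact ((translate v).inner_map_map _ _).symm

/-- The representation of the group algebra of the lattice by translations. -/
noncomputable def transHom (d : ℕ) : AddMonoidAlgebra ℂ (Fin d → ℤ) →ₐ[ℂ] (H d →L[ℂ] H d) :=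
  AddMonoidAlgebra.lift ℂ (H d →L[ℂ] H d) (Fin d → ℤ)
    { toFun := fun v => trans v.toAdd
      map_one' := trans_zero
      map_mul' := fun _ _ => trans_add _ _ }

theorem transHom_single (v : Fin d → ℤ) (a : ℂ) :
    transHom d (AddMonoidAlgebra.single v a) = a • trans v := by
  simp [transHom, AddMonoidAlgebra.lift_single]

/-- The symbol of `Δ_i` in the group algebra. -/
noncomputable def lapSymbol (i : Fin d) : AddMonoidAlgebra ℂ (Fin d → ℤ) :=
  AddMonoidAlgebra.single (Pi.single i 1) 2⁻¹ + AddMonoidAlgebra.single (Pi.single i (-1)) 2⁻¹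

theorem transHom_lapSymbol (i : Fin d) : transHom d (lapSymbol i) = laplacianCoord i := by
  rw [lapSymbol, map_add, transHom_single, transHom_single, laplacianCoord, smul_add]
  rfl

theorem laplacianCoord_eq (i : Fin d) :
    laplacianCoord i = (2⁻¹ : ℂ) • (trans (Pi.single i 1) + trans (Pi.single i (-1))) := rfl

theorem commute_transHom (p q : AddMonoidAlgebra ℂ (Fin d → ℤ)) :
    Commute (transHom d p) (transHom d q) := by
  rw [Commute, SemiconjBy, ← map_mul, ← map_mul, mul_comm]

theorem transHom_laplacian :
    transHom d (List.ofFn fun i : Fin d => lapSymbol i).prod = laplacian d := by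
  rw [map_list_prod, List.map_ofFn, laplacian]
  congr 2
  ext1 i
  exact transHom_lapSymbol i

theorem isSelfAdjoint_laplacianCoord (i : Fin d) : IsSelfAdjoint (laplacianCoord i) := by
  rw [IsSelfAdjoint, laplacianCoord_eq, star_smul, star_add, star_trans, star_trans,
    ← Pi.single_neg, ← Pi.single_neg, neg_neg, add_comm]
  simp

theorem commute_laplacianCoord (i j : Fin d) :
    Commute (laplacianCoord i) (laplacianCoord j) := by
  rw [← transHom_lapSymbol, ← transHom_lapSymbol]
  exact commute_transHom _ _

theorem isSelfAdjoint_laplacian : IsSelfAdjoint (laplacian d) := by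
  have key : ∀ l : List (Fin d), IsSelfAdjoint (l.map fun i => laplacianCoord i).prod := by
    intro l
    induction l with
    | nil => simp
    | cons i l ih =>
      rw [List.map_cons, List.prod_cons]
      refine (isSelfAdjoint_laplacianCoord i).commute_iff ih |>.mp ?_
      refine Commute.list_prod_right _ _ fun x hx => ?_
      obtain ⟨j, -, rfl⟩ := List.mem_map.mp hx
      exact commute_laplacianCoord i j
  have h := key (List.finRange d)
  rwa [← List.ofFn_eq_map] at h

theorem norm_laplacianCoord_le (i : Fin d) : ‖laplacianCoord i‖ ≤ 1 := by
  rw [laplacianCoord_eq, norm_smul]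
  have := (norm_add_le (trans (Pi.single i 1)) (trans (Pi.single i (-1)))).trans
    (add_le_add (norm_trans_le _) (norm_trans_le _))
  norm_num
  linarith

/-! ### Spectral projections and the continuous functional calculus. -/

section Spectral

variable {K : Type*} [NormedAddCommGroup K] [InnerProductSpace ℂ K] [CompleteSpace K]

theorem spectralProj_apply_mem (T : K →L[ℂ] K) (I : Set ℝ) (u : K) :
    spectralProj T I u ∈ (spectralCore T I).topologicalClosure :=
  Submodule.starProjection_apply_mem _ _

theorem isSelfAdjoint_spectralProj (T : K →L[ℂ] K) (I : Set ℝ) :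
    IsSelfAdjoint (spectralProj T I) := isSelfAdjoint_starProjection _

theorem spectralProj_mul_self (T : K →L[ℂ] K) (I : Set ℝ) :
    spectralProj T I * spectralProj T I = spectralProj T I :=
  (Submodule.isIdempotentElem_starProjection _).eq

theorem spectralProj_nonneg (T : K →L[ℂ] K) (I : Set ℝ) : 0 ≤ spectralProj T I := by
  rw [← spectralProj_mul_self]
  nth_rewrite 1 [← (isSelfAdjoint_spectralProj T I).star_eq]
  exact star_mul_self_nonneg _

theorem spectralProj_cfc_apply (T : K →L[ℂ] K) {I : Set ℝ} {h : ℝ → ℝ} (hc : Continuous h)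
    (h0 : ∀ t ∉ I, h t = 0) (u : K) : spectralProj T I (cfc h T u) = cfc h T u := by
  refine Submodule.starProjection_eq_self_iff.mpr (Submodule.le_topologicalClosure _ ?_)
  exact Submodule.mem_iSup_of_mem (p := fun f : {f : C(ℝ, ℝ) // ∀ x ∉ I, f x = 0} =>
    LinearMap.range (cfc (fun t => f.1 t) T).toLinearMap) ⟨⟨h, hc⟩, h0⟩ ⟨u, rfl⟩

theorem cfc_mul_spectralProj_eq_zero (T : K →L[ℂ] K) {I : Set ℝ} {k : ℝ → ℝ}
    (hc : Continuous k) (h0 : ∀ t ∈ I, k t = 0) : cfc k T * spectralProj T I = 0 := by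
  have h1 : spectralCore T I ≤ LinearMap.ker (cfc k T).toLinearMap := by
    refine iSup_le fun f => ?_
    rintro _ ⟨w, rfl⟩
    rw [LinearMap.mem_ker]
    have : cfc k T * cfc (fun t => f.1 t) T = 0 := by
      rw [← cfc_mul k (fun t => f.1 t) T hc.continuousOn f.1.continuous.continuousOn]
      have h2 : (fun t => k t * f.1 t) = fun _ => 0 := by
        ext t
        by_cases ht : t ∈ I
        · rw [h0 t ht, zero_mul]
        · rw [f.2 t ht, mul_zero]
      rw [h2, cfc_const_zero]
    exact congrArg (fun A : K →L[ℂ] K => A w) this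
  have h2 := Submodule.topologicalClosure_minimal _ h1 (ContinuousLinearMap.isClosed_ker (cfc k T))
  ext u
  exact h2 (spectralProj_apply_mem T I u)

/-- `C` commutes with every f(T), so it preserves the closed span of their ranges; being
self-adjoint, it then also preserves the orthogonal complement. -/
theorem commute_spectralProj {T C : K →L[ℂ] K} (hC : IsSelfAdjoint C) (h : Commute C T)
    (I : Set ℝ) : Commute C (spectralProj T I) := by
  have hinv : ∀ u ∈ (spectralCore T I).topologicalClosure,
      C u ∈ (spectralCore T I).topologicalClosure := by
    have h1 : spectralCore T I ≤ (spectralCore T I).comap C.toLinearMap := by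
      refine iSup_le fun f => ?_
      rintro _ ⟨w, rfl⟩
      have hcomm : Commute C (cfc (fun t => f.1 t) T) :=
        (h.symm.cfc_real (fun t => f.1 t)).symm
      refine Submodule.mem_iSup_of_mem (p := fun f : {f : C(ℝ, ℝ) // ∀ x ∉ I, f x = 0} =>
        LinearMap.range (cfc (fun t => f.1 t) T).toLinearMap) f ⟨C w, ?_⟩
      exact congrArg (fun A : K →L[ℂ] K => A w) hcomm.eq.symm
    intro u hu
    exact map_mem_closure C.continuous hu fun x hx => h1 hx
  have hPCP : spectralProj T I * C * spectralProj T I = C * spectralProj T I := by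
    ext u
    exact Submodule.starProjection_eq_self_iff.mpr (hinv _ (spectralProj_apply_mem T I u))
  have hP := isSelfAdjoint_spectralProj T I
  have h2 := congrArg star hPCP
  rw [star_mul, star_mul, star_mul, hP.star_eq, hC.star_eq, ← mul_assoc, hPCP] at h2
  exact h2

theorem cfc_mul_spectralProj_nonneg {T : K →L[ℂ] K} {I : Set ℝ}
    {k : ℝ → ℝ} (hc : Continuous k) (h0 : ∀ t ∈ I, 0 ≤ k t) :
    0 ≤ cfc k T * spectralProj T I := by
  -- The negative part of `k` vanishes on `I`, so the projection annihilates it and only the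
  -- nonnegative part remains.
  have hsplit : cfc k T = cfc (fun t => max (k t) 0) T + cfc (fun t => min (k t) 0) T := by
    rw [← cfc_add T (fun t => max (k t) 0) (fun t => min (k t) 0)]
    congr 1
    ext t
    simp [max_add_min]
  rw [hsplit, add_mul, cfc_mul_spectralProj_eq_zero (k := fun t => min (k t) 0) T (by fun_prop)
    (fun t ht => min_eq_right (h0 t ht)), add_zero]
  refine Commute.mul_nonneg (cfc_nonneg fun t _ => le_max_right _ _) (spectralProj_nonneg T I) ?_
  exact commute_spectralProj (cfc_predicate _ T)
    ((Commute.refl T).cfc_real _) I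

end Spectral

/-! ### Symmetry of the generators on their maximal domain -/

theorem genFun_apply (k : ℤ) (f : (Fin d → ℤ) → ℂ) (n : Fin d → ℤ) :
    genFun k f n = (1 / (4 * Complex.I)) * ∑ i : Fin d,
      ((2 * n i - k) * f (n - Pi.single i k) - (2 * n i + k) * f (n + Pi.single i k)) := by
  rw [genFun]
  congr 1
  refine Finset.sum_congr rfl fun i _ => ?_
  simp only [diffFun, posFun, Pi.sub_apply, Pi.add_apply, Pi.single_eq_same]
  push_cast
  ring

/-- A slowly varying cutoff on the lattice, increasing to `1` as `R → ∞`. -/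
noncomputable def cutoff (R : ℕ) (n : Fin d → ℤ) : ℝ := (R + 1) / (R + 1 + ‖n‖)

theorem cutoff_nonneg (R : ℕ) (n : Fin d → ℤ) : 0 ≤ cutoff R n := by
  unfold cutoff; positivity

theorem cutoff_le_one (R : ℕ) (n : Fin d → ℤ) : cutoff R n ≤ 1 := by
  unfold cutoff
  rw [div_le_one (by positivity)]
  linarith [norm_nonneg n]

theorem tendsto_cutoff (n : Fin d → ℤ) :
    Tendsto (fun R : ℕ => cutoff R n) atTop (𝓝 1) := by
  have h : Tendsto (fun R : ℕ => 1 - ‖n‖ * ((R : ℝ) + 1 + ‖n‖)⁻¹) atTop (𝓝 (1 - ‖n‖ * 0)) := by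
    refine Tendsto.const_sub _ (Tendsto.const_mul _ (tendsto_inv_atTop_zero.comp ?_))
    exact tendsto_atTop_add_const_right _ _
      (tendsto_atTop_add_const_right _ _ tendsto_natCast_atTop_atTop)
  rw [mul_zero, sub_zero] at h
  refine h.congr fun R => ?_
  have : (0 : ℝ) < R + 1 + ‖n‖ := by positivity
  unfold cutoff
  field_simp
  ring

theorem cutoff_mul_le (R : ℕ) (n : Fin d → ℤ) {c K : ℝ} (hK : 0 ≤ K) (hc : c ≤ 2 * ‖n‖ + K) :
    cutoff R n * c ≤ (R + 1) * (2 + K) := by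
  refine (mul_le_mul_of_nonneg_left hc (cutoff_nonneg R n)).trans ?_
  unfold cutoff
  have hn := norm_nonneg n
  rw [div_mul_eq_mul_div, div_le_iff₀ (by positivity), mul_assoc]
  refine mul_le_mul_of_nonneg_left ?_ (by positivity)
  have hR : (0 : ℝ) ≤ R := by positivity
  nlinarith [mul_nonneg hK hn, mul_nonneg hK hR]

/-- Increments of the cutoff are of order 1/(R + |n|), which absorbs the linear growth of the
coefficients uniformly in R: this is the domination needed as R → ∞. -/
theorem abs_cutoff_sub_mul_le (R : ℕ) (n m : Fin d → ℤ) {c K : ℝ} (hK : 0 ≤ K)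
    (hm : ‖n - m‖ ≤ K) (hc0 : 0 ≤ c) (hc : c ≤ 2 * ‖n‖ + K) :
    |cutoff R n - cutoff R m| * c ≤ K * (2 + K) := by
  have hn := norm_nonneg n
  have hm' := norm_nonneg m
  have hR : (0 : ℝ) ≤ R := by positivity
  have h1 : |cutoff R n - cutoff R m| ≤ K / (R + 1 + ‖n‖) := by
    have e : cutoff R n - cutoff R m =
        (‖m‖ - ‖n‖) / (R + 1 + ‖n‖) * cutoff R m := by
      unfold cutoff
      field_simp
      ring
    rw [e, abs_mul, abs_div, abs_of_nonneg (cutoff_nonneg R m),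
      abs_of_pos (show (0 : ℝ) < R + 1 + ‖n‖ by positivity)]
    refine (mul_le_of_le_one_right (by positivity) (cutoff_le_one R m)).trans ?_
    gcongr
    rw [abs_sub_comm]
    exact (abs_norm_sub_norm_le n m).trans hm
  refine (mul_le_mul h1 hc hc0 (by positivity)).trans ?_
  rw [div_mul_eq_mul_div, div_le_iff₀ (by positivity), mul_assoc]
  refine mul_le_mul_of_nonneg_left ?_ hK
  nlinarith [mul_nonneg hK hn, mul_nonneg hK hR]

theorem abs_apply_le_norm (n : Fin d → ℤ) (i : Fin d) : |(n i : ℝ)| ≤ ‖n‖ := by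
  have := norm_le_pi_norm n i
  rwa [Int.norm_eq_abs] at this

/-- A discrete integration by parts: a current with linearly growing coefficients over a summable
density has no flux at infinity. -/
theorem tendsto_tsum_cutoff_sub (i : Fin d) (k : ℤ) {q : (Fin d → ℤ) → ℂ} (hq : Summable q) :
    (∀ R, Summable fun n => (cutoff R n : ℂ) * ((2 * n i - k : ℂ) * q n -
      (2 * (n + Pi.single i k : Fin d → ℤ) i - k : ℂ) * q (n + Pi.single i k))) ∧
    Tendsto (fun R => ∑' n, (cutoff R n : ℂ) * ((2 * n i - k : ℂ) * q n -
      (2 * (n + Pi.single i k : Fin d → ℤ) i - k : ℂ) * q (n + Pi.single i k))) atTop (𝓝 0) := by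
  set e : Fin d → ℤ := Pi.single i k with he
  set a : (Fin d → ℤ) → ℝ := fun n => 2 * n i - k with ha
  set K : ℝ := |(k : ℝ)| with hKdef
  have hK : 0 ≤ K := abs_nonneg _
  have hnorm : ‖e‖ = K := by
    rw [he, Pi.norm_single, Int.norm_eq_abs]
  have ha1 : ∀ n, |a n| ≤ 2 * ‖n‖ + K := fun n => by
    refine (abs_sub _ _).trans ?_
    rw [abs_mul, abs_two]
    linarith [abs_apply_le_norm n i]
  have ha2 : ∀ n, |a n| ≤ 2 * ‖n - e‖ + K := fun n => by
    have : a n = 2 * ((n - e) i : ℤ) + k := by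
      simp [ha, he]; ring
    rw [this]
    refine (abs_add_le _ _).trans ?_
    rw [abs_mul, abs_two]
    linarith [abs_apply_le_norm (n - e) i]
  have hs1 : ∀ R, Summable fun n => (cutoff R n * a n : ℂ) * q n := fun R => by
    refine Summable.of_norm_bounded (hq.norm.mul_left ((R + 1) * (2 + K))) fun n => ?_
    rw [norm_mul, norm_mul, Complex.norm_real, Complex.norm_real, Real.norm_eq_abs,
      Real.norm_eq_abs, abs_of_nonneg (cutoff_nonneg _ _)]
    exact mul_le_mul_of_nonneg_right (cutoff_mul_le R n hK (ha1 n)) (norm_nonneg _)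
  have hs2 : ∀ R, Summable fun n => (cutoff R (n - e) * a n : ℂ) * q n := fun R => by
    refine Summable.of_norm_bounded (hq.norm.mul_left ((R + 1) * (2 + K))) fun n => ?_
    rw [norm_mul, norm_mul, Complex.norm_real, Complex.norm_real, Real.norm_eq_abs,
      Real.norm_eq_abs, abs_of_nonneg (cutoff_nonneg _ _)]
    exact mul_le_mul_of_nonneg_right (cutoff_mul_le R (n - e) hK (ha2 n)) (norm_nonneg _)
  have hs3 : ∀ R, Summable fun n => (cutoff R n * a (n + e) : ℂ) * q (n + e) := fun R => by
    have := (Equiv.addRight e).summable_iff.mpr (hs2 R)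
    refine this.congr fun n => ?_
    simp
  have hfun : ∀ R, (fun n => (cutoff R n : ℂ) * ((2 * n i - k : ℂ) * q n -
      (2 * (n + e : Fin d → ℤ) i - k : ℂ) * q (n + e))) = fun n =>
      (cutoff R n * a n : ℂ) * q n - (cutoff R n * a (n + e) : ℂ) * q (n + e) := fun R => by
    ext n
    simp only [ha]
    push_cast
    ring
  simp only [hfun]
  refine ⟨fun R => (hs1 R).sub (hs3 R), ?_⟩
  -- Translating the second sum moves the difference onto the cutoff; its increments tend to 0
  -- pointwise and stay bounded after multiplication by `a`.
  have hval : ∀ R, ∑' n, ((cutoff R n * a n : ℂ) * q n -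
      (cutoff R n * a (n + e) : ℂ) * q (n + e)) =
      ∑' n, (((cutoff R n - cutoff R (n - e)) * a n : ℝ) : ℂ) * q n := fun R => by
    rw [(hs1 R).tsum_sub (hs3 R)]
    have : ∑' n, (cutoff R n * a (n + e) : ℂ) * q (n + e) =
        ∑' n, (cutoff R (n - e) * a n : ℂ) * q n := by
      rw [← (Equiv.addRight e).tsum_eq fun n => (cutoff R (n - e) * a n : ℂ) * q n]
      simp
    rw [this, ← (hs1 R).tsum_sub (hs2 R)]
    refine tsum_congr fun n => ?_
    push_cast
    ring
  simp only [hval]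
  rw [show (0 : ℂ) = ∑' _ : Fin d → ℤ, (0 : ℂ) by simp]
  refine tendsto_tsum_of_dominated_convergence (hq.norm.mul_left (K * (2 + K))) (fun n => ?_)
    (Eventually.of_forall fun R n => ?_)
  · have h1 := (tendsto_cutoff n).sub (tendsto_cutoff (n - e))
    have h2 := ((h1.mul_const (a n)).ofReal).mul_const (q n)
    simpa using h2
  · rw [norm_mul, Complex.norm_real, Real.norm_eq_abs, abs_mul]
    refine mul_le_mul_of_nonneg_right ?_ (norm_nonneg _)
    refine abs_cutoff_sub_mul_le R n (n - e) hK ?_ (abs_nonneg _) (ha1 n)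
    simp [hnorm]

/-- The defect of symmetry is a discrete divergence: a current with coefficient 2 n_i - k minus its
translate by k in direction i. -/
theorem inner_genFun_sub (k : ℤ) (f h : (Fin d → ℤ) → ℂ) (n : Fin d → ℤ) :
    ⟪h n, genFun k f n⟫_ℂ - ⟪genFun k h n, f n⟫_ℂ = (1 / (4 * Complex.I)) * ∑ i,
      ((2 * n i - k : ℂ) *
        (⟪h n, f (n - Pi.single i k)⟫_ℂ + ⟪h (n - Pi.single i k), f n⟫_ℂ) -
      (2 * (n + Pi.single i k : Fin d → ℤ) i - k : ℂ) *
        (⟪h (n + Pi.single i k), f (n + Pi.single i k - Pi.single i k)⟫_ℂ +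
          ⟪h (n + Pi.single i k - Pi.single i k), f (n + Pi.single i k)⟫_ℂ)) := by
  have hcc : (starRingEnd ℂ) (1 / (4 * Complex.I)) = -(1 / (4 * Complex.I)) := by
    simp [Complex.conj_ofNat]
  rw [genFun_apply, genFun_apply]
  generalize 1 / (4 * Complex.I) = c at hcc
  simp only [RCLike.inner_apply, map_mul, map_sum, hcc]
  rw [mul_assoc, Finset.sum_mul, ← mul_assoc, mul_comm (f n), mul_assoc,
    Finset.mul_sum _ _ (f n), neg_mul, sub_neg_eq_add, ← mul_add, ← Finset.sum_add_distrib]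
  congr 1
  refine Finset.sum_congr rfl fun i _ => ?_
  simp [Complex.conj_ofNat]
  ring

theorem eq_zero_of_hasSum_inner_genFun_sub (k : ℤ) {f h : (Fin d → ℤ) → ℂ}
    (hq : ∀ i, Summable fun n =>
      ⟪h n, f (n - Pi.single i k)⟫_ℂ + ⟪h (n - Pi.single i k), f n⟫_ℂ) {s : ℂ}
    (hP : HasSum (fun n => ⟪h n, genFun k f n⟫_ℂ - ⟪genFun k h n, f n⟫_ℂ) s) : s = 0 := by
  have hlim1 : Tendsto (fun R : ℕ => ∑' n, (cutoff R n : ℂ) *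
      (⟪h n, genFun k f n⟫_ℂ - ⟪genFun k h n, f n⟫_ℂ)) atTop
      (𝓝 (∑' n, (⟪h n, genFun k f n⟫_ℂ - ⟪genFun k h n, f n⟫_ℂ))) := by
    refine tendsto_tsum_of_dominated_convergence hP.summable.norm (fun n => ?_)
      (Eventually.of_forall fun R n => ?_)
    · simpa using ((tendsto_cutoff n).ofReal).mul_const
        (⟪h n, genFun k f n⟫_ℂ - ⟪genFun k h n, f n⟫_ℂ)
    · rw [norm_mul, Complex.norm_real, Real.norm_eq_abs, abs_of_nonneg (cutoff_nonneg _ _)]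
      exact mul_le_of_le_one_left (norm_nonneg _) (cutoff_le_one _ _)
  have hlim2 : Tendsto (fun R : ℕ => ∑' n, (cutoff R n : ℂ) *
      (⟪h n, genFun k f n⟫_ℂ - ⟪genFun k h n, f n⟫_ℂ)) atTop (𝓝 0) := by
    have hl := (tendsto_finsetSum Finset.univ fun i _ =>
      (tendsto_tsum_cutoff_sub i k (hq i)).2).const_mul (1 / (4 * Complex.I))
    rw [Finset.sum_const_zero, mul_zero] at hl
    refine hl.congr fun R => ?_
    rw [← Summable.tsum_finsetSum fun i _ => (tendsto_tsum_cutoff_sub i k (hq i)).1 R,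
      ← tsum_mul_left]
    refine tsum_congr fun n => ?_
    rw [inner_genFun_sub, mul_left_comm (cutoff R n : ℂ), Finset.mul_sum _ _ (cutoff R n : ℂ)]
  have := tendsto_nhds_unique hlim1 hlim2
  rwa [hP.tsum_eq] at this

theorem inner_genFun_comm (k : ℤ) {u v w z : H d} (hw : ⇑w = genFun k ⇑u)
    (hz : ⇑z = genFun k ⇑v) : ⟪v, w⟫_ℂ = ⟪z, u⟫_ℂ := by
  have hP := (lp.hasSum_inner (𝕜 := ℂ) v w).sub (lp.hasSum_inner (𝕜 := ℂ) z u)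
  rw [hw, hz] at hP
  exact sub_eq_zero.mp (eq_zero_of_hasSum_inner_genFun_sub k (fun i =>
    (lp.summable_inner (𝕜 := ℂ) v (trans (Pi.single i k) u)).add
      (lp.summable_inner (𝕜 := ℂ) (trans (Pi.single i k) v) u)) hP)

/-! ### The generator on its maximal domain -/

theorem genFun_add (k : ℤ) (f h : (Fin d → ℤ) → ℂ) :
    genFun k (f + h) = genFun k f + genFun k h := by
  ext n
  simp only [genFun_apply, Pi.add_apply]
  rw [← mul_add, ← Finset.sum_add_distrib]
  congr 1
  exact Finset.sum_congr rfl fun i _ => by ring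

theorem genFun_smul (k : ℤ) (c : ℂ) (f : (Fin d → ℤ) → ℂ) :
    genFun k (c • f) = c • genFun k f := by
  ext n
  simp only [genFun_apply, Pi.smul_apply, smul_eq_mul]
  rw [mul_left_comm, Finset.mul_sum Finset.univ _ c]
  congr 1
  exact Finset.sum_congr rfl fun i _ => by ring

/-- The generator `A_k` on the maximal domain `{u | A_k u ∈ ℓ²}`. -/
noncomputable def maxGen (d : ℕ) (k : ℤ) : H d →ₗ.[ℂ] H d where
  domain :=
    { carrier := {u | Memℓp (genFun k ⇑u) 2}
      zero_mem' := by
        have : genFun k ⇑(0 : H d) = 0 := by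
          rw [lp.coeFn_zero, ← zero_smul ℂ (0 : (Fin d → ℤ) → ℂ), genFun_smul, zero_smul, zero_smul]
        rw [Set.mem_ofPred_eq, this]
        exact zero_memℓp
      add_mem' := fun {u v} hu hv => by
        rw [Set.mem_ofPred_eq, lp.coeFn_add, genFun_add]
        exact Memℓp.add hu hv
      smul_mem' := fun c u hu => by
        rw [Set.mem_ofPred_eq, lp.coeFn_smul, genFun_smul]
        exact Memℓp.const_smul hu c }
  toFun :=
    { toFun := fun u => ⟨genFun k ⇑(u : H d), u.2⟩
      map_add' := fun u v => by
        ext1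
        exact genFun_add k _ _
      map_smul' := fun c u => by
        ext1
        exact genFun_smul k _ _ }

theorem mem_maxGen_domain {k : ℤ} {u : H d} :
    u ∈ (maxGen d k).domain ↔ Memℓp (genFun k ⇑u) 2 := Iff.rfl

theorem coe_maxGen_apply (k : ℤ) (u : (maxGen d k).domain) :
    ⇑(maxGen d k u) = genFun k ⇑(u : H d) := rfl

theorem coe_gen_apply (k : ℤ) (u : finSupp d) : ⇑(gen d k u) = genFun k ⇑(u : H d) := rfl

theorem finSupp_le_maxGen_domain (k : ℤ) : finSupp d ≤ (maxGen d k).domain :=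
  fun _ hu => memlp_of_finite (genFun_finite k _ hu)

theorem single_mem_finSupp (n : Fin d → ℤ) (a : ℂ) :
    (lp.single 2 n a : H d) ∈ finSupp d := by
  refine (Set.finite_singleton n).subset fun m hm => ?_
  by_contra hne
  exact hm (by rw [lp.coeFn_single, Pi.single_eq_of_ne hne])

theorem dense_finSupp : Dense (finSupp d : Set (H d)) := by
  intro u
  refine mem_closure_of_tendsto (lp.hasSum_single (by norm_num) u) (Eventually.of_forall fun s => ?_)
  exact (finSupp d).sum_mem fun n _ => single_mem_finSupp n _

/-- Pairing with the image of a delta function reads off a value of `genFun k v`. This identifies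
the action of the adjoint pointwise. -/
theorem genFun_single (k : ℤ) (n : Fin d → ℤ) :
    ∃ w : H d, ⇑w = genFun k ⇑(lp.single 2 n 1 : H d) ∧
      ∀ v : H d, ⟪v, w⟫_ℂ = (starRingEnd ℂ) (genFun k ⇑v n) := by
  let w : H d := (1 / (4 * Complex.I)) • ∑ i, ((2 * n i + k : ℂ) • lp.single 2 (n + Pi.single i k) 1
    - (2 * n i - k : ℂ) • lp.single 2 (n - Pi.single i k) 1)
  refine ⟨w, ?_, fun v => ?_⟩
  · ext m
    rw [genFun_apply]
    simp only [w, lp.coeFn_smul, lp.coeFn_sum, lp.coeFn_sub, Pi.smul_apply, Finset.sum_apply,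
      Pi.sub_apply, lp.coeFn_single, smul_eq_mul]
    congr 1
    refine Finset.sum_congr rfl fun i _ => ?_
    congr 1
    · by_cases h : m = n + Pi.single i k
      · subst h
        simp
        ring
      · rw [Pi.single_eq_of_ne h, Pi.single_eq_of_ne fun h' => h (by rw [← h', sub_add_cancel]),
          mul_zero, mul_zero]
    · by_cases h : m = n - Pi.single i k
      · subst h
        simp
        ring
      · rw [Pi.single_eq_of_ne h, Pi.single_eq_of_ne fun h' => h (by rw [← h', add_sub_cancel_right]),
          mul_zero, mul_zero]
  · rw [genFun_apply]
    simp only [w, inner_smul_right, inner_sum, inner_sub_right, lp.inner_single_right, map_mul,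
      map_sum, map_sub, map_add, RCLike.inner_apply, one_mul, map_div₀, map_one, Complex.conj_I,
      Complex.conj_ofNat, map_intCast]
    rw [mul_neg, div_neg, neg_mul, ← mul_neg, ← Finset.sum_neg_distrib]
    congr 1
    exact Finset.sum_congr rfl fun i _ => by ring

/-- Symmetry on the maximal domain comes from the absence of flux at infinity. Conversely, testing
against delta functions shows that the adjoint acts as `genFun k`, so its domain is no larger than
the maximal one. -/
theorem isSelfAdjoint_maxGen (k : ℤ) : IsSelfAdjoint (maxGen d k) := by
  have hdense : Dense ((maxGen d k).domain : Set (H d)) :=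
    dense_finSupp.mono (finSupp_le_maxGen_domain k)
  have hle : maxGen d k ≤ (maxGen d k).adjoint := LinearPMap.IsFormalAdjoint.le_adjoint hdense
    fun x y => (inner_genFun_comm k rfl rfl).symm
  rw [LinearPMap.isSelfAdjoint_def]
  refine (LinearPMap.eq_of_le_of_domain_eq hle (le_antisymm hle.1 fun y hy => ?_)).symm
  have hadj := LinearPMap.adjoint_isFormalAdjoint hdense
  have key : genFun k ⇑y = ⇑((maxGen d k).adjoint ⟨y, hy⟩) := by
    ext n
    obtain ⟨w, hw, hin⟩ := genFun_single k n
    have hmem : (lp.single 2 n 1 : H d) ∈ (maxGen d k).domain :=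
      finSupp_le_maxGen_domain k (single_mem_finSupp n 1)
    have h1 := hadj ⟨y, hy⟩ ⟨_, hmem⟩
    have h2 : maxGen d k ⟨_, hmem⟩ = w := lp.ext hw.symm
    rw [h2, hin y, lp.inner_single_right] at h1
    simp only [RCLike.inner_apply, one_mul] at h1
    exact ((starRingEnd ℂ).injective h1).symm
  rw [mem_maxGen_domain, key]
  exact lp.memℓp _

theorem isConjugate_maxGen (κ : ℕ) : IsConjugate d κ (maxGen d κ) := by
  refine ⟨isSelfAdjoint_maxGen _, fun j => if j = 1 then 1 else 0, fun u =>
    ⟨finSupp_le_maxGen_domain _ u.2, ?_⟩⟩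
  have h := hasSum_single (f := fun j : ℕ =>
    ((if j + 1 = 1 then 1 else 0 : ℝ) : ℂ) • gen d (((j + 1) * κ : ℕ) : ℤ) u) 0
    (fun j hj => by simp [hj])
  convert h using 1
  ext1
  simp [coe_gen_apply, coe_maxGen_apply]

/-! ### Commutators -/

/-- `B` is the commutator `[T, i A_k]`, where `T` preserves the maximal domain of `A_k`. -/
def HasCommutator (k : ℤ) (T B : H d →L[ℂ] H d) : Prop :=
  ∀ u w : H d, ⇑w = genFun k ⇑u → genFun k ⇑(T u) = ⇑(T w + Complex.I • B u)

theorem HasCommutator.one (k : ℤ) : HasCommutator (d := d) k 1 0 := by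
  intro u w hw
  simp [hw]

theorem HasCommutator.mul {k : ℤ} {T T' B B' : H d →L[ℂ] H d} (h : HasCommutator k T B)
    (h' : HasCommutator k T' B') : HasCommutator k (T * T') (T * B' + B * T') := by
  intro u w hw
  have := h (T' u) (T' w + Complex.I • B' u) (h' u w hw).symm
  rw [mul_apply_eq_comp, this]
  congr 1
  simp only [mul_apply_eq_comp, add_apply, map_add, map_smul, smul_add]
  abel

theorem HasCommutator.inner_eq {k : ℤ} {T B : H d →L[ℂ] H d} (h : HasCommutator k T B)
    (hT : IsSelfAdjoint T) {u v w z : H d} (hw : ⇑w = genFun k ⇑u) (hz : ⇑z = genFun k ⇑v) :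
    ⟪v, B u⟫_ℂ = Complex.I * (⟪T v, w⟫_ℂ - ⟪z, T u⟫_ℂ) := by
  have h1 := inner_genFun_comm k (h u w hw).symm hz
  have h2 : ⟪T v, w⟫_ℂ = ⟪v, T w⟫_ℂ := by
    rw [← ContinuousLinearMap.adjoint_inner_right, ← ContinuousLinearMap.star_eq_adjoint,
      hT.star_eq]
  rw [← h1, h2, inner_add_right, inner_smul_right]
  linear_combination ⟪v, B u⟫_ℂ * Complex.I_mul_I

/-- The commutator `[Δ_i, i A_k]`. -/
noncomputable def lapComm (k : ℤ) (i : Fin d) : H d →L[ℂ] H d :=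
  (4⁻¹ : ℂ) • (trans (Pi.single i (k - 1)) + trans (Pi.single i (1 - k)) -
    trans (Pi.single i (k + 1)) - trans (Pi.single i (-(k + 1))))

theorem hasCommutator_laplacianCoord (k : ℤ) (i : Fin d) :
    HasCommutator k (laplacianCoord i) (lapComm k i) := by
  intro u w hw
  set e : Fin d → ℤ := Pi.single i 1 with he
  have hee : ∀ m : ℤ, (Pi.single i m : Fin d → ℤ) = m • e := fun m => by
    rw [he, ← Pi.single_smul, smul_eq_mul, mul_one]
  have hT : ∀ v : H d, ∀ n, laplacianCoord i v n = 2⁻¹ * (v (n - e) + v (n + e)) := fun v n => by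
    have : n - (-1 : ℤ) • e = n + e := by module
    simp only [laplacianCoord_eq, smul_apply, add_apply, lp.coeFn_smul, lp.coeFn_add,
      Pi.smul_apply, Pi.add_apply, trans_apply, hee, smul_eq_mul, this, one_smul]
  have hB : ∀ n, lapComm k i u n = 4⁻¹ * (u (n - (k - 1) • e) + u (n + (k - 1) • e) -
      u (n - (k + 1) • e) - u (n + (k + 1) • e)) := fun n => by
    have e1 : n - (1 - k) • e = n + (k - 1) • e := by module
    have e2 : n - (-(k + 1)) • e = n + (k + 1) • e := by module
    simp only [lapComm, smul_apply, sub_apply, add_apply, lp.coeFn_smul, lp.coeFn_sub,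
      lp.coeFn_add, Pi.smul_apply, Pi.sub_apply, Pi.add_apply, trans_apply, hee, smul_eq_mul,
      e1, e2]
  ext n
  have hR : (laplacianCoord i w + Complex.I • lapComm k i u : H d) n =
      laplacianCoord i w n + Complex.I * lapComm k i u n := rfl
  rw [hR, hT, hB, hw, genFun_apply, genFun_apply, genFun_apply]
  simp only [hT]
  -- Only the coordinate j = i of the position changes under translation by `e`, so the commutator
  -- reduces to a single correction term.
  have key : ∀ j : Fin d,
      ((2 * n j - k : ℂ) * (2⁻¹ * (u (n - Pi.single j k - e) + u (n - Pi.single j k + e))) -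
        (2 * n j + k : ℂ) * (2⁻¹ * (u (n + Pi.single j k - e) + u (n + Pi.single j k + e)))) =
      2⁻¹ * (((2 * ((n - e) j : ℤ) - k : ℂ) * u (n - e - Pi.single j k) -
          (2 * ((n - e) j : ℤ) + k : ℂ) * u (n - e + Pi.single j k)) +
        ((2 * ((n + e) j : ℤ) - k : ℂ) * u (n + e - Pi.single j k) -
          (2 * ((n + e) j : ℤ) + k : ℂ) * u (n + e + Pi.single j k))) +
      if j = i then (u (n - (k + 1) • e) + u (n + (k + 1) • e) - u (n - (k - 1) • e) -
        u (n + (k - 1) • e)) else 0 := fun j => by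
    rw [sub_right_comm n e, ← sub_add_eq_add_sub n (Pi.single j k) e, add_right_comm n e,
      sub_add_eq_add_sub n e]
    by_cases hj : j = i
    · subst hj
      have e1 : n - Pi.single j k - e = n - (k + 1) • e := by rw [hee]; module
      have e2 : n - Pi.single j k + e = n - (k - 1) • e := by rw [hee]; module
      have e3 : n + Pi.single j k - e = n + (k - 1) • e := by rw [hee]; module
      have e4 : n + Pi.single j k + e = n + (k + 1) • e := by rw [hee]; module
      rw [e1, e2, e3, e4, if_pos rfl]
      simp only [Pi.sub_apply, Pi.add_apply, he, Pi.single_eq_same]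
      push_cast
      ring
    · rw [if_neg hj]
      simp only [Pi.sub_apply, Pi.add_apply, he, Pi.single_eq_of_ne hj]
      push_cast
      ring
  rw [Finset.sum_congr rfl fun j _ => key j, Finset.sum_add_distrib, ← Finset.mul_sum,
    Finset.sum_add_distrib, Finset.sum_ite_eq' Finset.univ i, if_pos (Finset.mem_univ i), one_div,
    mul_inv, Complex.inv_I]
  ring

/-! ### The commutator of the Laplacian with the generators -/

/-- The commutator of `∏_{i ∈ l} Δ_i` with `i A_k`, by the Leibniz rule. -/
noncomputable def prodComm (k : ℤ) : List (Fin d) → (H d →L[ℂ] H d)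
  | [] => 0
  | i :: l => laplacianCoord i * prodComm k l +
      lapComm k i * (l.map fun j => laplacianCoord j).prod

theorem hasCommutator_prod (k : ℤ) (l : List (Fin d)) :
    HasCommutator k (l.map fun j => laplacianCoord j).prod (prodComm k l) := by
  induction l with
  | nil => exact HasCommutator.one k
  | cons i l ih =>
    rw [List.map_cons, List.prod_cons]
    exact (hasCommutator_laplacianCoord k i).mul ih

theorem laplacian_eq_prod_map :
    laplacian d = ((List.finRange d).map fun j => laplacianCoord j).prod := by
  rw [laplacian, List.ofFn_eq_map]

theorem hasCommutator_laplacian (k : ℤ) :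
    HasCommutator k (laplacian d) (prodComm k (List.finRange d)) := by
  rw [laplacian_eq_prod_map]
  exact hasCommutator_prod k _

theorem norm_lapComm_le (k : ℤ) (i : Fin d) : ‖lapComm k i‖ ≤ 1 := by
  have h (v : Fin d → ℤ) := norm_trans_le v
  have := (norm_sub_le _ _).trans (add_le_add ((norm_sub_le _ _).trans (add_le_add
    ((norm_add_le _ _).trans (add_le_add (h (Pi.single i (k - 1))) (h (Pi.single i (1 - k)))))
    (h (Pi.single i (k + 1))))) (h (Pi.single i (-(k + 1)))))
  rw [lapComm, norm_smul, norm_inv, Complex.norm_ofNat]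
  linarith

theorem norm_prod_laplacianCoord_le (l : List (Fin d)) :
    ‖(l.map fun j => laplacianCoord j).prod‖ ≤ 1 := by
  induction l with
  | nil => exact ContinuousLinearMap.norm_id_le
  | cons i l ih =>
    rw [List.map_cons, List.prod_cons]
    exact (norm_mul_le _ _).trans
      (mul_le_one₀ (norm_laplacianCoord_le i) (norm_nonneg _) ih)

/-- The bound does not depend on `k`; with summable coefficients it allows termwise limits in
infinite combinations of generators. -/
theorem norm_prodComm_le (k : ℤ) (l : List (Fin d)) : ‖prodComm k l‖ ≤ l.length := by
  induction l with
  | nil => simp [prodComm]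
  | cons i l ih =>
    rw [prodComm, List.length_cons, Nat.cast_add, Nat.cast_one]
    refine (norm_add_le _ _).trans (add_le_add ?_ ?_)
    · exact (norm_mul_le _ _).trans
        ((mul_le_of_le_one_left (norm_nonneg _) (norm_laplacianCoord_le i)).trans ih)
    · exact (norm_mul_le _ _).trans
        (mul_le_one₀ (norm_lapComm_le k i) (norm_nonneg _) (norm_prod_laplacianCoord_le l))

/-! ### Approximate eigenvectors -/

/-- `u` is a sequence of approximate eigenvectors of `T` for `z`. -/
def ApproxEigen (u : ℕ → H d) (T : H d →L[ℂ] H d) (z : ℂ) : Prop :=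
  Tendsto (fun N => T (u N) - z • u N) atTop (𝓝 0)

namespace ApproxEigen

variable {u : ℕ → H d} {T T' : H d →L[ℂ] H d} {z z' : ℂ}

theorem one : ApproxEigen u 1 1 := by
  simp [ApproxEigen]

theorem zero : ApproxEigen u 0 0 := by
  simp [ApproxEigen]

theorem add (h : ApproxEigen u T z) (h' : ApproxEigen u T' z') :
    ApproxEigen u (T + T') (z + z') := by
  have := Tendsto.add h h'
  rw [add_zero] at this
  refine this.congr fun N => ?_
  rw [add_apply, add_smul]
  abel

theorem smul (h : ApproxEigen u T z) (c : ℂ) : ApproxEigen u (c • T) (c * z) := by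
  have := Tendsto.const_smul h c
  rw [smul_zero] at this
  refine this.congr fun N => ?_
  rw [smul_apply, smul_sub, mul_smul]

theorem sub (h : ApproxEigen u T z) (h' : ApproxEigen u T' z') :
    ApproxEigen u (T - T') (z - z') := by
  have := h.add (h'.smul (-1))
  simpa [sub_eq_add_neg] using this

theorem mul (h : ApproxEigen u T z) (h' : ApproxEigen u T' z') :
    ApproxEigen u (T * T') (z * z') := by
  have h1 := (T.continuous.tendsto 0).comp h'
  have := h1.add (Tendsto.const_smul h z')
  rw [map_zero, smul_zero, add_zero] at this
  refine this.congr fun N => ?_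
  simp only [Function.comp, map_sub, map_smul, mul_apply_eq_comp, smul_sub, ← mul_smul,
    mul_comm z']
  abel

theorem inv_of_mul_eq_one (h : ApproxEigen u T z) (hz : z ≠ 0) (hT : T' * T = 1) :
    ApproxEigen u T' z⁻¹ := by
  have h1 := Tendsto.const_smul ((T'.continuous.tendsto 0).comp h) (-z⁻¹)
  rw [map_zero, smul_zero] at h1
  refine h1.congr fun N => ?_
  have h2 : T' (T (u N)) = u N := by rw [← mul_apply_eq_comp, hT]; rfl
  simp only [Function.comp, map_sub, map_smul, h2, smul_sub, smul_smul, neg_mul,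
    inv_mul_cancel₀ hz]
  module

end ApproxEigen

/-- `u` is a sequence of normalized compactly supported wave packets of quasi-momentum `ξ`. -/
structure IsWavePacket (u : ℕ → H d) (ξ : Fin d → ℝ) : Prop where
  mem_finSupp : ∀ N, u N ∈ finSupp d
  norm_eq : ∀ N, ‖u N‖ = 1
  approx : ∀ i, ApproxEigen u (trans (Pi.single i 1)) (Complex.exp (-(ξ i * Complex.I)))

theorem norm_sq_eq_tsum (u : H d) : ‖u‖ ^ 2 = ∑' n, ‖u n‖ ^ 2 := by
  have := lp.norm_rpow_eq_tsum (p := 2) (by norm_num) u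
  simpa using this

theorem norm_sq_le_card (u : H d) (s : Finset (Fin d → ℤ)) (h0 : ∀ n ∉ s, u n = 0)
    (h1 : ∀ n ∈ s, ‖u n‖ ≤ 1) : ‖u‖ ^ 2 ≤ s.card := by
  rw [norm_sq_eq_tsum, tsum_eq_sum (s := s) fun n hn => by rw [h0 n hn]; simp]
  refine (Finset.sum_le_card_nsmul s _ 1 fun n hn => ?_).trans (by simp)
  exact pow_le_one₀ (norm_nonneg _) (h1 n hn)

/-- The plane wave of quasi-momentum `ξ`. -/
noncomputable def planeWave (ξ : Fin d → ℝ) (n : Fin d → ℤ) : ℂ :=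
  Complex.exp ((∑ i, ξ i * n i : ℝ) * Complex.I)

theorem norm_planeWave (ξ : Fin d → ℝ) (n : Fin d → ℤ) : ‖planeWave ξ n‖ = 1 :=
  Complex.norm_exp_ofReal_mul_I _

theorem planeWave_sub_single (ξ : Fin d → ℝ) (n : Fin d → ℤ) (i : Fin d) :
    planeWave ξ (n - Pi.single i 1) = Complex.exp (-(ξ i * Complex.I)) * planeWave ξ n := by
  rw [planeWave, planeWave, ← Complex.exp_add]
  congr 1
  have : ∑ j, ξ j * ((n - Pi.single i 1 : Fin d → ℤ) j : ℝ) = -ξ i + ∑ j, ξ j * (n j : ℝ) := by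
    have h : ∀ j, ξ j * ((n - Pi.single i 1 : Fin d → ℤ) j : ℝ) =
        (if j = i then -ξ i else 0) + ξ j * n j := fun j => by
      by_cases hj : j = i
      · subst hj
        simp
        ring
      · simp [hj]
    rw [Finset.sum_congr rfl fun j _ => h j, Finset.sum_add_distrib, Finset.sum_ite_eq']
    simp
  rw [this]
  push_cast
  ring

/-- The box of side `N` in the lattice. -/
noncomputable def box (d N : ℕ) : Finset (Fin d → ℤ) := Fintype.piFinset fun _ => Finset.Ico 0 (N : ℤ)

/-- The slab of the box of side `N` where the `i`-th coordinate is `a`. -/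
noncomputable def slab (N : ℕ) (i : Fin d) (a : ℤ) : Finset (Fin d → ℤ) :=
  Fintype.piFinset (Function.update (fun _ => Finset.Ico 0 (N : ℤ)) i {a})

theorem card_box_eq (N : ℕ) (i : Fin d) (a : ℤ) : (box d N).card = N * (slab N i a).card := by
  rw [box, slab, Fintype.card_piFinset, Fintype.card_piFinset,
    Finset.prod_eq_mul_prod_sdiff_singleton_of_mem (Finset.mem_univ i),
    Finset.prod_eq_mul_prod_sdiff_singleton_of_mem (Finset.mem_univ i)
      (fun j => (Function.update (fun _ => Finset.Ico 0 (N : ℤ)) i {a} j).card)]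
  rw [Function.update_self, Finset.card_singleton, one_mul]
  congr 1
  · simp
  · refine Finset.prod_congr rfl fun j hj => ?_
    rw [Function.update_of_ne (by simpa using hj)]

theorem mem_slab {N : ℕ} {i : Fin d} {n : Fin d → ℤ}
    (h : ∀ j, j ≠ i → n j ∈ Finset.Ico 0 (N : ℤ)) : n ∈ slab N i (n i) := by
  rw [slab, Fintype.mem_piFinset]
  intro j
  by_cases hj : j = i
  · subst hj
    simp
  · rw [Function.update_of_ne hj]
    exact h j hj

open Classical in
/-- The plane wave cut off to a box. -/
noncomputable def boxWave (ξ : Fin d → ℝ) (N : ℕ) : H d :=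
  ⟨fun n => if n ∈ box d N then planeWave ξ n else 0, memlp_of_finite <|
    (box d N).finite_toSet.subset fun n hn => by
      by_contra h
      exact hn (if_neg h)⟩

open Classical in
theorem boxWave_apply (ξ : Fin d → ℝ) (N : ℕ) (n : Fin d → ℤ) :
    boxWave ξ N n = if n ∈ box d N then planeWave ξ n else 0 := rfl

theorem norm_sq_boxWave (ξ : Fin d → ℝ) (N : ℕ) : ‖boxWave ξ N‖ ^ 2 = (box d N).card := by
  rw [norm_sq_eq_tsum, tsum_eq_sum (s := box d N) fun n hn => by simp [boxWave_apply, hn]]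
  rw [Finset.sum_congr rfl fun n hn => by rw [boxWave_apply, if_pos hn, norm_planeWave]]
  simp

/-- A translated plane wave differs from a multiple of itself only where the box and its translate
disagree, that is on two opposite slabs; each has a fraction 1/N of the volume of the box. -/
theorem norm_sq_trans_boxWave_sub_le (ξ : Fin d → ℝ) (N : ℕ) (i : Fin d) :
    ‖trans (Pi.single i 1) (boxWave ξ N) -
      Complex.exp (-(ξ i * Complex.I)) • boxWave ξ N‖ ^ 2 ≤
      (slab N i 0).card + (slab N i N).card := by
  classical
  have hval : ∀ n, (trans (Pi.single i 1) (boxWave ξ N) -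
      Complex.exp (-(ξ i * Complex.I)) • boxWave ξ N : H d) n =
      Complex.exp (-(ξ i * Complex.I)) * planeWave ξ n *
        ((if n - Pi.single i 1 ∈ box d N then 1 else 0) - if n ∈ box d N then 1 else 0) := by
    intro n
    rw [lp.coeFn_sub, Pi.sub_apply, lp.coeFn_smul, Pi.smul_apply, trans_apply, boxWave_apply,
      boxWave_apply, planeWave_sub_single, smul_eq_mul]
    split_ifs <;> ring
  have hle : (((slab N i 0) ∪ (slab N i N)).card : ℝ) ≤
      (slab N i 0).card + (slab N i N).card := mod_cast Finset.card_union_le _ _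
  refine (norm_sq_le_card _ ((slab N i 0) ∪ (slab N i N)) (fun n hn => ?_) fun n _ => ?_).trans hle
  · rw [hval]
    have hiff : n - Pi.single i 1 ∈ box d N ↔ n ∈ box d N := by
      rw [Finset.mem_union, not_or] at hn
      by_cases hj : ∀ j, j ≠ i → n j ∈ Finset.Ico 0 (N : ℤ)
      · have h0 : n i ≠ 0 := fun h => hn.1 (h ▸ mem_slab hj)
        have hN : n i ≠ N := fun h => hn.2 (h ▸ mem_slab hj)
        rw [box, Fintype.mem_piFinset, Fintype.mem_piFinset]
        refine forall_congr' fun j => ?_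
        by_cases hji : j = i
        · subst hji
          simp only [Pi.sub_apply, Pi.single_eq_same, Finset.mem_Ico]
          omega
        · simp [hji]
      · push Not at hj
        obtain ⟨j, hji, hj⟩ := hj
        rw [box, Fintype.mem_piFinset, Fintype.mem_piFinset]
        refine iff_of_false (fun h => hj ?_) fun h => hj (h j)
        simpa [hji] using h j
    rw [if_congr hiff rfl rfl, sub_self, mul_zero]
  · rw [hval, norm_mul, norm_mul, norm_planeWave,
      show -(ξ i * Complex.I) = ((-ξ i : ℝ) : ℂ) * Complex.I by push_cast; ring,
      Complex.norm_exp_ofReal_mul_I]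
    split_ifs <;> simp

theorem exists_isWavePacket (ξ : Fin d → ℝ) : ∃ u : ℕ → H d, IsWavePacket u ξ := by
  have hcard : ∀ N : ℕ, 0 < ((box d (N + 1)).card : ℝ) := fun N => by
    have : (box d (N + 1)).Nonempty := ⟨0, by simp [box, Fintype.mem_piFinset]⟩
    exact_mod_cast this.card_pos
  have hpos : ∀ N : ℕ, 0 < ‖boxWave ξ (N + 1)‖ := fun N => by
    have := norm_sq_boxWave ξ (N + 1)
    refine lt_of_le_of_ne (norm_nonneg _) fun h => ?_
    rw [← h] at this
    have h2 := hcard N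
    rw [← this] at h2
    norm_num at h2
  refine ⟨fun N => ((‖boxWave ξ (N + 1)‖⁻¹ : ℝ) : ℂ) • boxWave ξ (N + 1), fun N => ?_, fun N => ?_,
    fun i => ?_⟩
  · refine (finSupp d).smul_mem _ ((box d (N + 1)).finite_toSet.subset fun n hn => ?_)
    by_contra h
    exact hn (if_neg h)
  · rw [norm_smul, Complex.norm_real, norm_inv, norm_norm, inv_mul_cancel₀ (hpos N).ne']
  · rw [ApproxEigen, tendsto_zero_iff_norm_tendsto_zero]
    have hlim : Tendsto (fun N : ℕ => √(2 * (1 / ((N : ℝ) + 1)))) atTop (𝓝 0) := by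
      have := (tendsto_one_div_add_atTop_nhds_zero_nat (𝕜 := ℝ)).const_mul 2
      have h2 := (Real.continuous_sqrt.tendsto _).comp this
      rwa [mul_zero, Real.sqrt_zero] at h2
    refine squeeze_zero (fun _ => norm_nonneg _) (fun N => ?_) hlim
    refine Real.le_sqrt_of_sq_le ?_
    rw [map_smul, smul_comm, ← smul_sub, norm_smul, mul_pow, Complex.norm_real, norm_inv,
      norm_norm, inv_pow, norm_sq_boxWave, inv_mul_le_iff₀ (hcard N)]
    refine (norm_sq_trans_boxWave_sub_le ξ (N + 1) i).trans (le_of_eq ?_)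
    have h0 : ((box d (N + 1)).card : ℝ) = (N + 1) * (slab (N + 1) i 0).card := by
      exact_mod_cast card_box_eq (N + 1) i 0
    have h1 : ((box d (N + 1)).card : ℝ) = (N + 1) * (slab (N + 1) i (N + 1 : ℕ)).card := by
      exact_mod_cast card_box_eq (N + 1) i (N + 1 : ℕ)
    have hN : (0 : ℝ) < N + 1 := by positivity
    field_simp
    linear_combination -h0 - h1

theorem one_sub_sq_mul_U_cos (k : ℕ) (θ : ℝ) :
    (1 - cos θ ^ 2) * (Polynomial.Chebyshev.U ℝ ((k : ℤ) - 1)).eval (cos θ) =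
      sin θ * sin (k * θ) := by
  have hU := Polynomial.Chebyshev.U_real_cos θ ((k : ℤ) - 1)
  push_cast at hU
  rw [sub_add_cancel] at hU
  rw [← hU, ← sin_sq]
  ring

namespace IsWavePacket

variable {u : ℕ → H d} {ξ : Fin d → ℝ}

theorem approx_trans (h : IsWavePacket u ξ) (i : Fin d) (m : ℤ) :
    ApproxEigen u (trans (Pi.single i m)) (Complex.exp (-((m * ξ i : ℝ) * Complex.I))) := by
  have hne := Complex.exp_ne_zero (-(ξ i * Complex.I))
  have hinv : ApproxEigen u (trans (Pi.single i (-1))) (Complex.exp (-(ξ i * Complex.I)))⁻¹ := by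
    refine (h.approx i).inv_of_mul_eq_one hne ?_
    rw [← trans_add, ← Pi.single_add, neg_add_cancel, Pi.single_zero, trans_zero]
  induction m with
  | zero => simpa [trans_zero] using ApproxEigen.one
  | succ m ih =>
    have := ih.mul (h.approx i)
    rw [← trans_add, ← Pi.single_add, ← Complex.exp_add] at this
    convert this using 2
    push_cast
    ring
  | pred m ih =>
    have := ih.mul hinv
    rw [← trans_add, ← Pi.single_add, ← Complex.exp_neg, ← Complex.exp_add] at this
    convert this using 2
    · rw [sub_eq_add_neg]
    · push_cast
      ring

theorem approx_laplacianCoord (h : IsWavePacket u ξ) (i : Fin d) :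
    ApproxEigen u (laplacianCoord i) (cos (ξ i) : ℝ) := by
  have := ((h.approx_trans i 1).add (h.approx_trans i (-1))).smul 2⁻¹
  rw [← laplacianCoord_eq] at this
  convert this using 1
  rw [Complex.ofReal_cos, Complex.cos]
  push_cast
  ring_nf

theorem approx_lapComm (h : IsWavePacket u ξ) (k : ℤ) (i : Fin d) :
    ApproxEigen u (lapComm k i) (sin (ξ i) * sin (k * ξ i) : ℝ) := by
  have := ((((h.approx_trans i (k - 1)).add (h.approx_trans i (1 - k))).sub
    (h.approx_trans i (k + 1))).sub (h.approx_trans i (-(k + 1)))).smul 4⁻¹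
  rw [← lapComm] at this
  convert this using 1
  have e : sin (ξ i) * sin (k * ξ i) =
      2⁻¹ * (cos ((k - 1 : ℤ) * ξ i) - cos ((k + 1 : ℤ) * ξ i)) := by
    push_cast
    rw [sub_mul, add_mul, one_mul, cos_sub, cos_add]
    ring
  rw [e]
  push_cast
  rw [Complex.cos, Complex.cos]
  ring_nf

theorem approx_prod (h : IsWavePacket u ξ) (l : List (Fin d)) :
    ApproxEigen u (l.map fun j => laplacianCoord j).prod ((l.map fun j => cos (ξ j)).prod : ℝ) := by
  induction l with
  | nil => simpa using ApproxEigen.one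
  | cons i l ih =>
    rw [List.map_cons, List.map_cons, List.prod_cons, List.prod_cons, Complex.ofReal_mul]
    exact (h.approx_laplacianCoord i).mul ih

theorem approx_laplacian (h : IsWavePacket u ξ) :
    ApproxEigen u (laplacian d) (∏ i, cos (ξ i) : ℝ) := by
  have := h.approx_prod (List.finRange d)
  rwa [← laplacian_eq_prod_map, ← List.ofFn_eq_map, List.prod_ofFn] at this

theorem approx_prodComm (h : IsWavePacket u ξ) (k : ℤ) {l : List (Fin d)} (hl : l.Nodup) :
    ApproxEigen u (prodComm k l)
      (∑ i ∈ l.toFinset, (∏ j ∈ l.toFinset.erase i, cos (ξ j)) * (sin (ξ i) * sin (k * ξ i)) :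
        ℝ) := by
  induction l with
  | nil => simpa [prodComm] using ApproxEigen.zero
  | cons i l ih =>
    obtain ⟨hi, hl⟩ := List.nodup_cons.mp hl
    have hi' : i ∉ l.toFinset := by simpa using hi
    have := ((h.approx_laplacianCoord i).mul (ih hl)).add
      ((h.approx_lapComm k i).mul (h.approx_prod l))
    rw [prodComm]
    convert this using 1
    rw [← Complex.ofReal_mul, ← Complex.ofReal_mul, ← Complex.ofReal_add, List.toFinset_cons,
      Finset.sum_insert hi', Finset.erase_insert hi', Finset.mul_sum, add_comm,
      ← List.prod_toFinset _ hl, mul_comm (sin (ξ i) * _)]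
    congr 2
    refine Finset.sum_congr rfl fun j hj => ?_
    have hij : i ≠ j := fun h => hi' (h ▸ hj)
    rw [Finset.erase_insert_of_ne hij, Finset.prod_insert (by simp [hi]), mul_assoc]

/-- The identity (1 - cos²θ) U_{k-1}(cos θ) = sin θ sin kθ is what makes `g k` the symbol of the
commutator. -/
theorem approx_commutator (h : IsWavePacket u ξ) (k : ℕ) :
    ApproxEigen u (prodComm k (List.finRange d)) (g k fun i => cos (ξ i) : ℝ) := by
  have := h.approx_prodComm k (List.nodup_finRange d)
  convert this using 2
  rw [g, List.toFinset_finRange]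
  refine Finset.sum_congr rfl fun i _ => ?_
  rw [mul_assoc, one_sub_sq_mul_U_cos, Int.cast_natCast]

end IsWavePacket

/-! ### Points of the energy surface and the Mourre estimate -/

theorem mem_spectrum_of_approxEigen {u : ℕ → H d} (hu : ∀ N, ‖u N‖ = 1) {T : H d →L[ℂ] H d}
    {E : ℝ} (h : ApproxEigen u T E) : E ∈ spectrum ℝ T := by
  rw [spectrum.mem_iff]
  rintro ⟨R, hR⟩
  have h1 : Tendsto (fun N => (↑R⁻¹ : H d →L[ℂ] H d) (T (u N) - (E : ℂ) • u N)) atTop (𝓝 0) := by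
    have := ((↑R⁻¹ : H d →L[ℂ] H d).continuous.tendsto 0).comp h
    rwa [map_zero] at this
  have h2 : ∀ N, (↑R⁻¹ : H d →L[ℂ] H d) (T (u N) - (E : ℂ) • u N) = -u N := fun N => by
    have e : T (u N) - (E : ℂ) • u N = -((R : H d →L[ℂ] H d) (u N)) := by
      rw [hR, sub_apply, Algebra.algebraMap_eq_smul_one, smul_apply, one_apply_eq_self, neg_sub]
      rfl
    rw [e, map_neg, ← mul_apply_eq_comp, Units.inv_mul]
    rfl
  simp only [h2] at h1
  have h3 := h1.norm
  simp only [norm_neg, hu, norm_zero] at h3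
  exact one_ne_zero (tendsto_nhds_unique tendsto_const_nhds h3)

theorem exists_wavePacket_of_mem {E : ℝ} {x : Fin d → ℝ} (hx : x ∈ energySurface d E) :
    ∃ (u : ℕ → H d) (ξ : Fin d → ℝ), IsWavePacket u ξ ∧ (fun i => cos (ξ i)) = x ∧
      ApproxEigen u (laplacian d) E := by
  obtain ⟨u, hu⟩ := exists_isWavePacket fun i => arccos (x i)
  have hc : (fun i => cos (arccos (x i))) = x := funext fun i => cos_arccos (hx.1 i).1 (hx.1 i).2
  refine ⟨u, _, hu, hc, ?_⟩
  have := hu.approx_laplacian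
  rwa [show ∏ i, cos (arccos (x i)) = ∏ i, x i from
    Finset.prod_congr rfl fun i _ => congrFun hc i, hx.2] at this

theorem mem_spectrum_laplacian {E : ℝ} {x : Fin d → ℝ} (hx : x ∈ energySurface d E) :
    E ∈ spectrum ℝ (laplacian d) := by
  obtain ⟨u, ξ, hu, -, hE⟩ := exists_wavePacket_of_mem hx
  exact mem_spectrum_of_approxEigen hu.norm_eq hE

theorem tendsto_spectralProj_sub {K : Type*} [NormedAddCommGroup K] [InnerProductSpace ℂ K]
    [CompleteSpace K] {u : ℕ → K} {T : K →L[ℂ] K} (hT : IsSelfAdjoint T) {E a b : ℝ}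
    (h : Tendsto (fun N => T (u N) - (E : ℂ) • u N) atTop (𝓝 0)) (hE : E ∈ Ioo a b) :
    Tendsto (fun N => spectralProj T (Ioo a b) (u N) - u N) atTop (𝓝 0) := by
  set δ := min (E - a) (b - E) with hδ
  have hδ0 : 0 < δ := lt_min (sub_pos.mpr hE.1) (sub_pos.mpr hE.2)
  have hmax : ∀ t : ℝ, max (δ ^ 2) ((t - E) ^ 2) ≠ 0 := fun t =>
    (lt_of_lt_of_le (by positivity) (le_max_left _ _)).ne'
  -- The quotient is a continuous substitute for 1/(t - E): the bump k = 1 - q·(t - E) equals 1 at E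
  -- and vanishes outside (a, b), and k(T)u - u = -q(T)(T - E)u tends to 0.
  set q : ℝ → ℝ := fun t => (t - E) / max (δ ^ 2) ((t - E) ^ 2) with hq
  have hqc : Continuous q := by
    refine Continuous.div (by fun_prop) (by fun_prop) hmax
  set k : ℝ → ℝ := fun t => 1 - q t * (t - E) with hk
  have hkc : Continuous k := by fun_prop
  have hk0 : ∀ t ∉ Ioo a b, k t = 0 := fun t ht => by
    have hle : δ ^ 2 ≤ (t - E) ^ 2 := by
      rw [sq_le_sq, abs_of_pos hδ0]
      rw [mem_Ioo, not_and_or, not_lt, not_lt] at ht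
      rcases ht with ht | ht
      · rw [abs_sub_comm]
        exact (min_le_left _ _).trans ((sub_le_sub_left ht E).trans (le_abs_self _))
      · exact (min_le_right _ _).trans ((sub_le_sub_right ht E).trans (le_abs_self _))
    have h3 : (t - E) ^ 2 ≠ 0 := by have := hmax t; rwa [max_eq_right hle] at this
    simp only [hk, hq, max_eq_right hle]
    rw [div_mul_eq_mul_div, ← sq, div_self h3, sub_self]
  have hcfc : ∀ v, cfc k T v = v - cfc q T (T v - (E : ℂ) • v) := by
    intro v
    have e : cfc k T = 1 - cfc q T * (T - algebraMap ℝ _ E) := by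
      rw [hk, cfc_sub (fun _ => 1) (fun t => q t * (t - E)) T, cfc_mul q (fun t => t - E) T,
        cfc_sub (fun t => t) (fun _ => E) T, cfc_const_one ℝ T, cfc_id' ℝ T, cfc_const E T]
    rw [e, sub_apply, mul_apply_eq_comp, sub_apply, Algebra.algebraMap_eq_smul_one, smul_apply,
      one_apply_eq_self]
    rfl
  have hlim : Tendsto (fun N => cfc k T (u N) - u N) atTop (𝓝 0) := by
    have := ((cfc q T).continuous.tendsto 0).comp h
    rw [map_zero] at this
    have h2 := this.neg
    rw [neg_zero] at h2
    refine h2.congr fun N => ?_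
    rw [hcfc]
    simp
  have h3 := ((spectralProj T (Ioo a b)).continuous.tendsto 0).comp hlim
  rw [map_zero] at h3
  have h4 := hlim.sub h3
  rw [sub_zero] at h4
  refine h4.congr fun N => ?_
  simp only [Function.comp, map_sub, spectralProj_cfc_apply T hkc hk0]
  abel

/-! ### Summability of the coefficients of a conjugate operator. -/

theorem genFun_single_zero_apply (i : Fin d) {k l : ℕ} (hk : 0 < k) (hl : 0 < l) :
    genFun k (Pi.single (0 : Fin d → ℤ) (1 : ℂ)) (Pi.single i (l : ℤ)) =
      if k = l then k / (4 * Complex.I) else 0 := by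
  have hplus : ∀ j : Fin d, (Pi.single i (l : ℤ) + Pi.single j (k : ℤ) : Fin d → ℤ) ≠ 0 := by
    intro j h
    have hj := congrFun h j
    by_cases hij : j = i
    · subst hij
      simp at hj
      omega
    · simp [hij] at hj
      omega
  have hminus : ∀ j : Fin d, (Pi.single i (l : ℤ) - Pi.single j (k : ℤ) : Fin d → ℤ) = 0 →
      j = i ∧ k = l := by
    intro j h
    have hj := congrFun h j
    by_cases hij : j = i
    · subst hij
      simp at hj
      omega
    · simp [hij] at hj
      omega
  rw [genFun_apply, Finset.sum_eq_single i (fun j _ hj => ?_) (by simp)]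
  · rw [Pi.single_eq_of_ne (hplus i)]
    split_ifs with h
    · subst h
      simp only [sub_self, Pi.single_eq_same]
      push_cast
      field_simp
      ring
    · rw [Pi.single_eq_of_ne fun h0 => h (hminus i h0).2]
      simp
  · rw [Pi.single_eq_of_ne (hplus j), Pi.single_eq_of_ne fun h0 => hj (hminus j h0).1]
    simp

/-- The coefficients of a combination which converges on the compactly supported sequences are
absolutely summable. -/
theorem summable_coeff (i : Fin d) {κ : ℕ} (hκ : 0 < κ) {ρ : ℕ → ℝ} {w : H d}
    (h : HasSum (fun j : ℕ => (ρ (j + 1) : ℂ) • gen d (((j + 1) * κ : ℕ) : ℤ)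
      ⟨lp.single 2 0 1, single_mem_finSupp 0 1⟩) w) :
    Summable fun j => |ρ (j + 1)| := by
  -- Applied to the delta function at 0, the combination takes at (l+1)κ on the i-th axis the value
  -- ρ_{l+1}(l+1)κ/(4i); no other frequency reaches that site. Thus (l ρ_l) is square-summable, and
  -- 2Ac ≤ A² + c² with c = 1/(l+1) makes ρ summable.
  have hw : ∀ l : ℕ, w (Pi.single i (((l + 1) * κ : ℕ) : ℤ)) =
      ρ (l + 1) * (((l + 1) * κ : ℕ) / (4 * Complex.I)) := by
    intro l
    have h1 := h.mapL (lp.evalCLM ℂ (fun _ : Fin d → ℤ => ℂ) 2 (Pi.single i (((l + 1) * κ : ℕ) : ℤ)))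
    refine h1.unique ?_
    have hval : ∀ j : ℕ, (lp.evalCLM ℂ (fun _ : Fin d → ℤ => ℂ) 2
        (Pi.single i (((l + 1) * κ : ℕ) : ℤ))) ((ρ (j + 1) : ℂ) • gen d (((j + 1) * κ : ℕ) : ℤ)
        ⟨lp.single 2 0 1, single_mem_finSupp 0 1⟩) = if j = l then
        ρ (l + 1) * (((l + 1) * κ : ℕ) / (4 * Complex.I)) else 0 := fun j => by
      have e : (lp.evalCLM ℂ (fun _ : Fin d → ℤ => ℂ) 2
        (Pi.single i (((l + 1) * κ : ℕ) : ℤ))) ((ρ (j + 1) : ℂ) • gen d (((j + 1) * κ : ℕ) : ℤ)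
        ⟨lp.single 2 0 1, single_mem_finSupp 0 1⟩) = ρ (j + 1) *
          genFun (((j + 1) * κ : ℕ) : ℤ) (Pi.single (0 : Fin d → ℤ) (1 : ℂ))
            (Pi.single i (((l + 1) * κ : ℕ) : ℤ)) := by
        rw [map_smul, smul_eq_mul]
        rfl
      rw [e, genFun_single_zero_apply i (by positivity) (by positivity)]
      by_cases hj : j = l
      · subst hj
        simp
      · have : ¬ (j + 1) * κ = (l + 1) * κ := fun hh => hj (by
          have := Nat.eq_of_mul_eq_mul_right hκ hh
          omega)
        rw [if_neg this, if_neg hj, mul_zero]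
    simp only [hval]
    exact hasSum_ite_eq l _
  have hs : Summable fun l : ℕ => ‖w (Pi.single i (((l + 1) * κ : ℕ) : ℤ))‖ ^ 2 := by
    have h2 := (lp.memℓp w).summable (by norm_num)
    have hinj : Function.Injective fun l : ℕ => (Pi.single i (((l + 1) * κ : ℕ) : ℤ) : Fin d → ℤ) := by
      intro l l' hll
      have := Pi.single_injective i hll
      have := Nat.eq_of_mul_eq_mul_right hκ (Int.ofNat_inj.mp this)
      omega
    have h3 := h2.comp_injective hinj
    simpa [Function.comp_def] using h3
  have hs2 : Summable fun l : ℕ => (1 : ℝ) / ((l + 1 : ℕ) : ℝ) ^ 2 :=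
    (summable_nat_add_iff 1).mpr (Real.summable_one_div_nat_pow.mpr (by norm_num))
  refine Summable.of_nonneg_of_le (fun _ => abs_nonneg _) (fun l => ?_)
    ((hs.mul_left 2).add (hs2.mul_left 2))
  have hn : ‖w (Pi.single i (((l + 1) * κ : ℕ) : ℤ))‖ = |ρ (l + 1)| * (((l + 1) * κ : ℕ) / 4) := by
    rw [hw, norm_mul, norm_div, norm_mul, Complex.norm_real, Complex.norm_natCast, Complex.norm_I,
      Complex.norm_ofNat, mul_one, Real.norm_eq_abs]
  have hκ1 : (1 : ℝ) ≤ κ := by exact_mod_cast hκ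
  have hl : (0 : ℝ) < ((l + 1 : ℕ) : ℝ) := by positivity
  have hge : |ρ (l + 1)| * (((l + 1 : ℕ) : ℝ) / 4) ≤ ‖w (Pi.single i (((l + 1) * κ : ℕ) : ℤ))‖ := by
    rw [hn, Nat.cast_mul]
    refine mul_le_mul_of_nonneg_left ?_ (abs_nonneg _)
    nlinarith
  set A := ‖w (Pi.single i (((l + 1) * κ : ℕ) : ℤ))‖
  set c := 1 / ((l + 1 : ℕ) : ℝ) with hc
  have : |ρ (l + 1)| ≤ 4 * (A * c) := by
    rw [hc, mul_one_div, ← mul_div_assoc, le_div_iff₀ hl]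
    linarith
  rw [← one_div_pow, ← hc]
  nlinarith [sq_nonneg (A - c)]

/-- A strict Mourre estimate near `E` bounds the symbol of the commutator from below on the constant
energy surface. -/
theorem le_tsum_of_mourreEstimate (hd : 0 < d) {κ : ℕ} (hκ : 0 < κ) {A : H d →ₗ.[ℂ] H d}
    {ρ : ℕ → ℝ} (hρ : ∀ u : finSupp d, ∃ hu : (u : H d) ∈ A.domain,
      HasSum (fun j : ℕ => (ρ (j + 1) : ℂ) • gen d (((j + 1) * κ : ℕ) : ℤ) u) (A ⟨u, hu⟩))
    {E a b γ : ℝ} (hE : E ∈ Ioo a b) (hM : MourreEstimate A (Ioo a b) γ)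
    {x : Fin d → ℝ} (hx : x ∈ energySurface d E) :
    (Summable fun j => ρ (j + 1) * g ((j + 1) * κ) x) ∧
      γ ≤ ∑' j, ρ (j + 1) * g ((j + 1) * κ) x := by
  obtain ⟨B, hB, hpos⟩ := hM
  obtain ⟨u, ξ, hu, rfl, happ⟩ := exists_wavePacket_of_mem hx
  set x : Fin d → ℝ := fun i => cos (ξ i)
  set C : ℕ → H d →L[ℂ] H d := fun j => prodComm (((j + 1) * κ : ℕ) : ℤ) (List.finRange d) with hC
  have hCn : ∀ j, ‖C j‖ ≤ d := fun j => (norm_prodComm_le _ _).trans (by simp)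
  have hsum : Summable fun j => |ρ (j + 1)| := by
    obtain ⟨_, h⟩ := hρ ⟨lp.single 2 0 1, single_mem_finSupp 0 1⟩
    exact summable_coeff ⟨0, hd⟩ hκ h
  -- On compactly supported vectors the series for A may be inserted in the form defining B; each
  -- term is then the expectation of a bounded commutator.
  have hinner : ∀ N, ⟪u N, B (u N)⟫_ℂ = ∑' j, (ρ (j + 1) : ℂ) * ⟪u N, C j (u N)⟫_ℂ := by
    intro N
    obtain ⟨hmem, hN⟩ := hρ ⟨u N, hu.mem_finSupp N⟩
    rw [hB ⟨u N, hmem⟩ ⟨u N, hmem⟩ (hu.mem_finSupp N) (hu.mem_finSupp N)]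
    have h1 := hN.mapL (innerSL ℂ (laplacian d (u N)))
    have h2 := (hN.mapL (innerSL ℂ (laplacian d (u N)))).star
    have h3 := (h1.sub h2).mul_left Complex.I
    simp only [innerSL_apply_apply, RCLike.star_def, inner_conj_symm] at h3
    refine h3.tsum_eq.symm.trans (tsum_congr fun j => ?_)
    have := (hasCommutator_laplacian (d := d) (((j + 1) * κ : ℕ) : ℤ)).inner_eq
      isSelfAdjoint_laplacian (u := u N) (v := u N)
      (w := gen d (((j + 1) * κ : ℕ) : ℤ) ⟨u N, hu.mem_finSupp N⟩)
      (z := gen d (((j + 1) * κ : ℕ) : ℤ) ⟨u N, hu.mem_finSupp N⟩) rfl rfl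
    rw [hC]
    simp only [this, inner_smul_left, inner_smul_right, Complex.conj_ofReal]
    ring
  have hg : ∀ j, Tendsto (fun N => ⟪u N, C j (u N)⟫_ℂ) atTop (𝓝 (g ((j + 1) * κ) x : ℝ)) := by
    intro j
    have h1 := hu.approx_commutator ((j + 1) * κ)
    have h2 : Tendsto (fun N => ⟪u N, C j (u N) - (g ((j + 1) * κ) x : ℂ) • u N⟫_ℂ) atTop (𝓝 0) := by
      refine squeeze_zero_norm (fun N => ?_) (tendsto_zero_iff_norm_tendsto_zero.mp h1)
      refine (norm_inner_le_norm _ _).trans ?_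
      rw [hu.norm_eq, one_mul]
    have h3 := h2.add_const (g ((j + 1) * κ) x : ℂ)
    rw [zero_add] at h3
    refine h3.congr fun N => ?_
    rw [inner_sub_right, inner_smul_right, inner_self_eq_norm_sq_to_K, hu.norm_eq]
    simp
  have hle : ∀ j N, ‖⟪u N, C j (u N)⟫_ℂ‖ ≤ d := fun j N => by
    refine (norm_inner_le_norm _ _).trans ?_
    have := (C j).le_opNorm (u N)
    rw [hu.norm_eq, mul_one] at this
    rw [hu.norm_eq, one_mul]
    exact this.trans (hCn j)
  have hgle : ∀ j, |g ((j + 1) * κ) x| ≤ d := fun j => by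
    have := le_of_tendsto (hg j).norm (Eventually.of_forall fun N => hle j N)
    rwa [Complex.norm_real] at this
  have hGsum : Summable fun j => ρ (j + 1) * g ((j + 1) * κ) x := by
    refine Summable.of_norm_bounded (hsum.mul_right (d : ℝ)) fun j => ?_
    rw [norm_mul]
    exact mul_le_mul_of_nonneg_left (hgle j) (abs_nonneg _)
  refine ⟨hGsum, ?_⟩
  set G := ∑' j, ρ (j + 1) * g ((j + 1) * κ) x with hG
  -- Dominated convergence with majorant d|ρ_j| exchanges the sum over frequencies with the limit
  -- along the wave packets.
  have hlimB : Tendsto (fun N => ⟪u N, B (u N)⟫_ℂ) atTop (𝓝 (G : ℂ)) := by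
    simp only [hinner]
    rw [hG, Complex.ofReal_tsum]
    refine tendsto_tsum_of_dominated_convergence (hsum.mul_right (d : ℝ)) (fun j => ?_)
      (Eventually.of_forall fun N j => ?_)
    · rw [Complex.ofReal_mul]
      exact (hg j).const_mul _
    · rw [norm_mul, Complex.norm_real]
      exact mul_le_mul_of_nonneg_left (hle j N) (abs_nonneg _)
  set P := spectralProj (laplacian d) (Ioo a b) with hP
  have hPu : Tendsto (fun N => P (u N) - u N) atTop (𝓝 0) :=
    tendsto_spectralProj_sub isSelfAdjoint_laplacian happ hE
  have hPn : ∀ N, ‖P (u N)‖ ≤ 1 := fun N =>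
    (Submodule.norm_starProjection_apply_le _ _).trans (hu.norm_eq N).le
  have hPsa : ∀ v w : H d, ⟪v, P w⟫_ℂ = ⟪P v, w⟫_ℂ := fun v w => by
    rw [← ContinuousLinearMap.adjoint_inner_left, ← ContinuousLinearMap.star_eq_adjoint,
      (isSelfAdjoint_spectralProj _ _).star_eq]
  -- The packets are asymptotically fixed by P, so compressing B by P does not change the limit.
  have hlim1 : Tendsto (fun N => ⟪u N, (P * B * P) (u N)⟫_ℂ) atTop (𝓝 (G : ℂ)) := by
    have hdiff : Tendsto (fun N => ⟪P (u N) - u N, B (P (u N))⟫_ℂ + ⟪u N, B (P (u N) - u N)⟫_ℂ)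
        atTop (𝓝 0) := by
      have hz := (tendsto_zero_iff_norm_tendsto_zero.mp hPu).const_mul (2 * ‖B‖)
      rw [mul_zero] at hz
      refine squeeze_zero_norm (fun N => ?_) hz
      refine (norm_add_le _ _).trans ?_
      have e1 := (norm_inner_le_norm (𝕜 := ℂ) (P (u N) - u N) (B (P (u N)))).trans
        (mul_le_mul_of_nonneg_left ((B.le_opNorm _).trans
          (mul_le_of_le_one_right (norm_nonneg _) (hPn N))) (norm_nonneg _))
      have e2 := (norm_inner_le_norm (𝕜 := ℂ) (u N) (B (P (u N) - u N))).trans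
        (mul_le_mul_of_nonneg_left (B.le_opNorm _) (norm_nonneg _))
      rw [hu.norm_eq, one_mul] at e2
      linarith
    have := hdiff.add hlimB
    rw [zero_add] at this
    refine this.congr fun N => ?_
    rw [mul_apply_eq_comp, mul_apply_eq_comp, hPsa, inner_sub_left, map_sub, inner_sub_right]
    ring
  have hlim2 : Tendsto (fun N => ⟪u N, (γ • P) (u N)⟫_ℂ) atTop (𝓝 (γ : ℂ)) := by
    have h1 : Tendsto (fun N => ⟪u N, P (u N) - u N⟫_ℂ) atTop (𝓝 0) := by
      refine squeeze_zero_norm (fun N => ?_) (tendsto_zero_iff_norm_tendsto_zero.mp hPu)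
      refine (norm_inner_le_norm _ _).trans ?_
      rw [hu.norm_eq, one_mul]
    have h2 := (h1.add_const 1).const_mul (γ : ℂ)
    rw [zero_add, mul_one] at h2
    refine h2.congr fun N => ?_
    have e : (γ • P) (u N) = (γ : ℂ) • P (u N) := rfl
    rw [e, inner_smul_right, inner_sub_right, inner_self_eq_norm_sq_to_K, hu.norm_eq]
    simp
  have hre := Complex.continuous_re.tendsto (G : ℂ) |>.comp hlim1
  have hre2 := Complex.continuous_re.tendsto (γ : ℂ) |>.comp hlim2
  rw [Complex.ofReal_re] at hre hre2
  refine le_of_tendsto_of_tendsto' hre2 hre fun N => ?_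
  have := ((ContinuousLinearMap.le_def _ _).mp hpos).re_inner_nonneg_right (u N)
  rw [sub_apply, inner_sub_right, map_sub, sub_nonneg] at this
  exact this

/-- A Mourre estimate would make G = ∑ ρ_j g_{jκ} at least γ > 0 at every x_q, whereas the linear
relation expresses G(x_m) as a nonpositive combination of positive numbers. -/
theorem thetaM_subset_theta (hd : 0 < d) {κ : ℕ} (hκ : 0 < κ) (m : ℕ) :
    ThetaM d m κ ⊆ Theta d κ := by
  rintro E ⟨x, ω, hx, hω, hg⟩
  refine ⟨mem_spectrum_laplacian (hx m le_rfl), ?_⟩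
  rintro ⟨-, A, ⟨-, ρ, hρ⟩, a, b, γ, hE, hγ, hM⟩
  have key := fun q hq => le_tsum_of_mourreEstimate hd hκ hρ hE hM (hx q hq)
  have hsum : ∑' j, ρ (j + 1) * g ((j + 1) * κ) (x m) =
      ∑ q ∈ Finset.range m, ω q * ∑' j, ρ (j + 1) * g ((j + 1) * κ) (x q) := by
    simp only [← tsum_mul_left]
    rw [← Summable.tsum_finsetSum fun q hq =>
      (key q (Finset.mem_range.mp hq).le).1.mul_left (ω q)]
    refine tsum_congr fun j => ?_
    rw [hg (j + 1) (by omega), Finset.mul_sum]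
    exact Finset.sum_congr rfl fun q _ => by ring
  have h1 := (key m le_rfl).2
  rw [hsum] at h1
  have h2 : ∑ q ∈ Finset.range m, ω q * ∑' j, ρ (j + 1) * g ((j + 1) * κ) (x q) ≤ 0 :=
    Finset.sum_nonpos fun q hq => by
      have hq := Finset.mem_range.mp hq
      exact mul_nonpos_of_nonpos_of_nonneg (hω q hq) (hγ.le.trans (key q hq.le).2)
  linarith

/-! ### The strict Mourre estimate above `cos (π / 4)` in dimension three -/

section Algebra

theorem trans_eq_transHom (v : Fin d → ℤ) :
    trans v = transHom d (AddMonoidAlgebra.single v 1) := by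
  rw [transHom_single, one_smul]

/-- This is sin ξ sin 4ξ = 4c(1 - c²)(2c² - 1) with c = cos ξ, lifted to the group algebra, where
the only relation between a shift and its inverse is `s * t = 1`. -/
theorem lapComm_four (i : Fin d) :
    lapComm 4 i = transHom d (4 * lapSymbol i * (1 - lapSymbol i ^ 2) * (2 * lapSymbol i ^ 2 - 1)) := by
  set s : AddMonoidAlgebra ℂ (Fin d → ℤ) := AddMonoidAlgebra.single (Pi.single i 1) 1 with hs
  set t : AddMonoidAlgebra ℂ (Fin d → ℤ) := AddMonoidAlgebra.single (Pi.single i (-1)) 1 with ht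
  have hst : s * t = 1 := by
    rw [hs, ht, AddMonoidAlgebra.single_mul_single, ← Pi.single_add, add_neg_cancel,
      Pi.single_zero, mul_one]
    rfl
  have hspow : ∀ m : ℕ, AddMonoidAlgebra.single (Pi.single i (m : ℤ)) 1 = s ^ m := fun m => by
    rw [hs, AddMonoidAlgebra.single_pow, one_pow, ← Pi.single_smul]
    simp
  have htpow : ∀ m : ℕ, AddMonoidAlgebra.single (Pi.single i (-(m : ℤ))) 1 = t ^ m := fun m => by
    rw [ht, AddMonoidAlgebra.single_pow, one_pow, ← Pi.single_smul]
    simp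
  have hlap : lapSymbol i = (2⁻¹ : ℂ) • (s + t) := by
    rw [lapSymbol, hs, ht, smul_add, AddMonoidAlgebra.smul_single, AddMonoidAlgebra.smul_single,
      smul_eq_mul, mul_one]
  have h3 : trans (Pi.single i (4 - 1)) = transHom d (s ^ 3) := by
    rw [trans_eq_transHom, ← hspow]; rfl
  have h3' : trans (Pi.single i (1 - 4)) = transHom d (t ^ 3) := by
    rw [trans_eq_transHom, ← htpow]; rfl
  have h5 : trans (Pi.single i (4 + 1)) = transHom d (s ^ 5) := by
    rw [trans_eq_transHom, ← hspow]; rfl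
  have h5' : trans (Pi.single i (-(4 + 1))) = transHom d (t ^ 5) := by
    rw [trans_eq_transHom, ← htpow]; rfl
  rw [lapComm, h3, h3', h5, h5', ← map_add, ← map_sub, ← map_sub, ← map_smul]
  congr 1
  set D := lapSymbol i with hD
  have h2 : 2 * D = s + t := by
    rw [hlap, two_mul, ← add_smul]
    norm_num
  -- Multiplying by 16 clears denominators, so that only 2D = s + t occurs.
  have h16 : (16 : ℂ) • ((4⁻¹ : ℂ) • (s ^ 3 + t ^ 3 - s ^ 5 - t ^ 5)) =
      (16 : ℂ) • (4 * D * (1 - D ^ 2) * (2 * D ^ 2 - 1)) := by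
    rw [smul_smul, show (16 : ℂ) * 4⁻¹ = 4 by norm_num, show (4 : ℂ) = ((4 : ℕ) : ℂ) by norm_num,
      show (16 : ℂ) = ((16 : ℕ) : ℂ) by norm_num, Nat.cast_smul_eq_nsmul, Nat.cast_smul_eq_nsmul,
      nsmul_eq_mul, nsmul_eq_mul]
    push_cast
    have e : 16 * (4 * D * (1 - D ^ 2) * (2 * D ^ 2 - 1)) =
        4 * (2 * D) * (4 - (2 * D) ^ 2) * ((2 * D) ^ 2 - 2) := by ring
    rw [e, h2]
    linear_combination (4 * (5 * (s + t) ^ 3 - (s + t) * (5 * s * t + 8))) * hst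
  exact smul_right_injective _ (by norm_num : (16 : ℂ) ≠ 0) h16

end Algebra

section Positivity

variable {K : Type*} [NormedAddCommGroup K] [InnerProductSpace ℂ K] [CompleteSpace K]
  {R : Type*} [CommRing R] [Algebra ℝ R] {Φ : R →ₐ[ℝ] (K →L[ℂ] K)} {P : K →L[ℂ] K}

/-- The operator `Φ r` is self-adjoint, commutes with `P`, and is nonnegative on the range of `P`. -/
structure NonnegOn (Φ : R →ₐ[ℝ] (K →L[ℂ] K)) (P : K →L[ℂ] K) (r : R) : Prop where
  isSelfAdjoint : IsSelfAdjoint (Φ r)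
  commute : Commute (Φ r) P
  nonneg : 0 ≤ Φ r * P

namespace NonnegOn

variable {r s : R}

theorem add (hr : NonnegOn Φ P r) (hs : NonnegOn Φ P s) : NonnegOn Φ P (r + s) where
  isSelfAdjoint := by rw [map_add]; exact hr.1.add hs.1
  commute := by rw [map_add]; exact hr.2.add_left hs.2
  nonneg := by rw [map_add, add_mul]; exact add_nonneg hr.3 hs.3

theorem mul (hP : P * P = P) (hr : NonnegOn Φ P r) (hs : NonnegOn Φ P s) :
    NonnegOn Φ P (r * s) := by
  have hcomm : Commute (Φ r) (Φ s) := by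
    rw [Commute, SemiconjBy, ← map_mul, ← map_mul, mul_comm]
  refine ⟨?_, ?_, ?_⟩
  · rw [map_mul]
    exact (hr.1.commute_iff hs.1).mp hcomm
  · rw [map_mul]
    exact hr.2.mul_left hs.2
  · have e : Φ (r * s) * P = Φ r * P * (Φ s * P) := by
      rw [map_mul, mul_assoc (Φ r) P, ← mul_assoc P, ← hs.2.eq, mul_assoc (Φ s), hP, mul_assoc]
    rw [e]
    refine Commute.mul_nonneg hr.3 hs.3 ?_
    exact (hcomm.mul_right hr.2).mul_left (hs.2.symm.mul_right (Commute.refl P))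

theorem algebraMap (hP0 : 0 ≤ P) {c : ℝ} (hc : 0 ≤ c) :
    NonnegOn Φ P (algebraMap ℝ R c) where
  isSelfAdjoint := by
    rw [AlgHom.commutes]
    exact IsSelfAdjoint.algebraMap _ (IsSelfAdjoint.all c)
  commute := by
    rw [AlgHom.commutes]
    exact Algebra.commutes c P
  nonneg := by
    rw [AlgHom.commutes, ← Algebra.smul_def]
    exact smul_nonneg hc hP0

end NonnegOn

/-- The strict Mourre estimate for a product of three commuting self-adjoint contractions, in a
spectral interval `(a, b)` with `1 < 2 a²`. -/
theorem mourre_of_commuting (Φ : R →ₐ[ℝ] (K →L[ℂ] K)) {t : Fin 3 → R}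
    (hsa : ∀ i, IsSelfAdjoint (Φ (t i))) (hn : ∀ i, ‖Φ (t i)‖ ≤ 1) {a b : ℝ} (ha : 0 < a)
    (ha2 : 1 < 2 * a ^ 2) {T B : K →L[ℂ] K}
    (hT : T = Φ (t 0 * t 1 * t 2))
    (hB : B = Φ (4 * (t 0 * t 1 * t 2) * ∑ i, (1 - t i ^ 2) * (2 * t i ^ 2 - 1))) :
    (4 * a * (2 * a ^ 2 - 1) * (1 - b ^ 2)) • spectralProj T (Ioo a b) ≤
      spectralProj T (Ioo a b) * B * spectralProj T (Ioo a b) := by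
  set P := spectralProj T (Ioo a b) with hPdef
  have hP : P * P = P := spectralProj_mul_self _ _
  have hP0 : 0 ≤ P := spectralProj_nonneg _ _
  have hcomm : ∀ r s, Commute (Φ r) (Φ s) := fun r s => by
    rw [Commute, SemiconjBy, ← map_mul, ← map_mul, mul_comm]
  have hcommP : ∀ r, IsSelfAdjoint (Φ r) → Commute (Φ r) P := fun r hr =>
    commute_spectralProj hr (by rw [hT]; exact hcomm _ _) _
  have hTsa : IsSelfAdjoint T := by
    rw [hT, map_mul, map_mul]
    refine ((IsSelfAdjoint.commute_iff ?_ (hsa 2)).mp ?_)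
    · exact ((hsa 0).commute_iff (hsa 1)).mp (hcomm _ _)
    · rw [← map_mul]
      exact hcomm _ _
  have hpos : ∀ r, 0 ≤ Φ r → NonnegOn Φ P r := fun r hr =>
    have h := IsSelfAdjoint.of_nonneg hr
    ⟨h, hcommP r h, Commute.mul_nonneg hr hP0 (hcommP r h)⟩
  have hcfc : ∀ (k : ℝ → ℝ) (r : R), Continuous k → (∀ x ∈ Ioo a b, 0 ≤ k x) → Φ r = cfc k T →
      NonnegOn Φ P r := fun k r hk hk0 hr => by
    have h : IsSelfAdjoint (Φ r) := by rw [hr]; exact cfc_predicate _ _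
    exact ⟨h, hcommP r h, by rw [hr]; exact cfc_mul_spectralProj_nonneg hk hk0⟩
  have hc : ∀ c : ℝ, 0 ≤ c → NonnegOn Φ P (algebraMap ℝ R c) := fun c h =>
    NonnegOn.algebraMap hP0 h
  set D := t 0 * t 1 * t 2 with hD
  have hTsq : cfc (fun x : ℝ => x ^ 2) T = Φ (D ^ 2) := by
    rw [cfc_pow_id T 2, hT, map_pow]
  have h1 : NonnegOn Φ P (D - algebraMap ℝ R a) := by
    refine hcfc (fun x => x - a) _ (by fun_prop) (fun x hx => sub_nonneg.mpr hx.1.le) ?_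
    rw [cfc_sub (fun x => x) (fun _ => a) T, cfc_id' ℝ T, cfc_const a T, map_sub,
      AlgHom.commutes, hT]
  have h2 : NonnegOn Φ P (D ^ 2 - algebraMap ℝ R (a ^ 2)) := by
    refine hcfc (fun x => x ^ 2 - a ^ 2) _ (by fun_prop)
      (fun x hx => sub_nonneg.mpr (pow_le_pow_left₀ ha.le hx.1.le 2)) ?_
    rw [cfc_sub (fun x => x ^ 2) (fun _ => a ^ 2) T, hTsq, cfc_const (a ^ 2) T, map_sub,
      AlgHom.commutes]
  have h3 : NonnegOn Φ P (algebraMap ℝ R (b ^ 2) - D ^ 2) := by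
    refine hcfc (fun x => b ^ 2 - x ^ 2) _ (by fun_prop)
      (fun x hx => sub_nonneg.mpr (pow_le_pow_left₀ (ha.le.trans hx.1.le) hx.2.le 2)) ?_
    rw [cfc_sub (fun _ => b ^ 2) (fun x => x ^ 2) T, hTsq, cfc_const (b ^ 2) T, map_sub,
      AlgHom.commutes]
  have hy0 : ∀ i, 0 ≤ Φ (t i ^ 2) := fun i => by
    rw [map_pow, sq]
    nth_rewrite 1 [← (hsa i).star_eq]
    exact star_mul_self_nonneg _
  have hy : ∀ i, NonnegOn Φ P (t i ^ 2) := fun i => hpos _ (hy0 i)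
  have hX : ∀ i, NonnegOn Φ P (1 - t i ^ 2) := fun i => hpos _ (by
    rw [map_sub, map_one, sub_nonneg, ← CStarAlgebra.norm_le_one_iff_of_nonneg _ (hy0 i), map_pow, sq]
    exact (norm_mul_le _ _).trans (mul_le_one₀ (hn i) (norm_nonneg _) (hn i)))
  -- Contractivity of the other two factors gives t_i² ≥ D² ≥ a² on the range of P; the difference
  -- t_i² - D² is written as t_i²(1 - t_j² t_k²).
  have hya : ∀ i j k, D = t i * t j * t k → NonnegOn Φ P (t i ^ 2 - algebraMap ℝ R (a ^ 2)) := by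
    intro i j k hijk
    have e : t i ^ 2 - algebraMap ℝ R (a ^ 2) = (D ^ 2 - algebraMap ℝ R (a ^ 2)) +
        t i ^ 2 * ((1 - t j ^ 2) + t j ^ 2 * (1 - t k ^ 2)) := by
      rw [hijk]; ring
    rw [e]
    exact h2.add ((hy i).mul hP ((hX j).add ((hy j).mul hP (hX k))))
  have hya' : ∀ i, NonnegOn Φ P (t i ^ 2 - algebraMap ℝ R (a ^ 2)) := by
    intro i
    fin_cases i
    · exact hya 0 1 2 hD
    · exact hya 1 0 2 (by rw [hD]; ring)
    · exact hya 2 0 1 (by rw [hD]; ring)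
  have h2c := hc 2 zero_le_two
  have hη := hc (2 * a ^ 2 - 1) (by linarith)
  have hW : ∀ i, NonnegOn Φ P (algebraMap ℝ R 2 * ((1 - t i ^ 2) *
      (t i ^ 2 - algebraMap ℝ R (a ^ 2)))) := fun i => h2c.mul hP ((hX i).mul hP (hya' i))
  have hZ : ∀ i, NonnegOn Φ P (algebraMap ℝ R 2 * ((1 - t i ^ 2) *
      (t i ^ 2 - algebraMap ℝ R (a ^ 2))) + algebraMap ℝ R (2 * a ^ 2 - 1) * (1 - t i ^ 2)) :=
    fun i => (hW i).add (hη.mul hP (hX i))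
  -- With X_i = 1 - t_i² and η = 2a² - 1, the certificate combines X_i(2t_i² - 1) = 2X_i(t_i² - a²)
  -- + ηX_i, the splitting D = (D - a) + a, and ∑ X_i = 1 - D² + X_0X_1t_2² + X_0X_2 + X_1X_2. The
  -- last gives ∑ X_i ≥ 1 - b².
  have hfin := (hc 4 zero_le_four).mul hP ((h1.mul hP (((hZ 0).add (hZ 1)).add (hZ 2))).add
    ((hc a ha.le).mul hP ((((hW 0).add (hW 1)).add (hW 2)).add
      (hη.mul hP (((((hX 0).mul hP (hX 1)).mul hP (hy 2)).add
        (((hX 0).mul hP (hX 2)).add ((hX 1).mul hP (hX 2)))).add h3)))))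
  have key : NonnegOn Φ P (4 * D * ∑ i, (1 - t i ^ 2) * (2 * t i ^ 2 - 1) -
      algebraMap ℝ R (4 * a * (2 * a ^ 2 - 1) * (1 - b ^ 2))) := by
    convert hfin using 1
    rw [Fin.sum_univ_three]
    simp only [map_mul, map_sub, map_pow, map_one, map_ofNat]
    rw [hD]
    ring
  have hle := key.nonneg
  have hPB := key.commute
  rw [map_sub, AlgHom.commutes, ← hB] at hle hPB
  rw [sub_mul, sub_nonneg, ← Algebra.smul_def] at hle
  have hPB2 : Commute B P := by
    have := hPB.add_left (Algebra.commutes (4 * a * (2 * a ^ 2 - 1) * (1 - b ^ 2)) P)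
    rwa [sub_add_cancel] at this
  rwa [← hPB2.eq, mul_assoc B, hP]

end Positivity

theorem laplacian_three :
    laplacian 3 = transHom 3 (lapSymbol 0 * lapSymbol 1 * lapSymbol 2) := by
  rw [← transHom_laplacian]
  congr 1
  simp [List.ofFn_succ, mul_assoc]

theorem prodComm_four_three : prodComm 4 (List.finRange 3) =
    transHom 3 (4 * (lapSymbol 0 * lapSymbol 1 * lapSymbol 2) *
      ∑ i, (1 - lapSymbol i ^ 2) * (2 * lapSymbol i ^ 2 - 1)) := by
  have h : List.finRange 3 = [0, 1, 2] := rfl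
  rw [h]
  simp only [prodComm, lapComm_four, ← transHom_lapSymbol, List.map_cons, List.map_nil,
    List.prod_cons, List.prod_nil, mul_zero, mul_one, zero_add, ← map_mul, ← map_add]
  congr 1
  rw [Fin.sum_univ_three]
  ring

theorem Ioo_subset_mu : Ioo (cos (π / 4)) 1 ⊆ mu 3 4 := by
  rintro E ⟨hE1, hE2⟩
  have hc0 : 0 < cos (π / 4) := by rw [cos_pi_div_four]; positivity
  have hc2 : 2 * cos (π / 4) ^ 2 = 1 := by
    rw [cos_pi_div_four, div_pow, Real.sq_sqrt zero_le_two]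
    norm_num
  have hE0 : 0 < E := hc0.trans hE1
  have hx : (![E, 1, 1] : Fin 3 → ℝ) ∈ energySurface 3 E := by
    refine ⟨fun l => ?_, by simp [Fin.prod_univ_three]⟩
    fin_cases l
    · exact ⟨by simp; linarith, by simp; linarith⟩
    · simp
    · simp
  obtain ⟨a, ha1, ha2⟩ := exists_between hE1
  obtain ⟨b, hb1, hb2⟩ := exists_between hE2
  have ha0 : 0 < a := hc0.trans ha1
  have hb0 : 0 < b := hE0.trans hb1
  have ha3 : 1 < 2 * a ^ 2 := by nlinarith
  refine ⟨mem_spectrum_laplacian hx, maxGen 3 4, isConjugate_maxGen 4, a, b,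
    4 * a * (2 * a ^ 2 - 1) * (1 - b ^ 2), ⟨ha2, hb1⟩, ?_, prodComm 4 (List.finRange 3), ?_, ?_⟩
  · have : 0 < 1 - b ^ 2 := by nlinarith
    have : 0 < 2 * a ^ 2 - 1 := by linarith
    positivity
  · intro u v _ _
    exact (hasCommutator_laplacian 4).inner_eq isSelfAdjoint_laplacian
      (w := maxGen 3 4 u) (z := maxGen 3 4 v) rfl rfl
  · refine mourre_of_commuting ((transHom 3).restrictScalars ℝ) (t := lapSymbol)
      (fun i => ?_) (fun i => ?_) ha0 ha3 laplacian_three prodComm_four_three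
    · change IsSelfAdjoint (transHom 3 (lapSymbol i))
      rw [transHom_lapSymbol]
      exact isSelfAdjoint_laplacianCoord i
    · change ‖transHom 3 (lapSymbol i)‖ ≤ 1
      rw [transHom_lapSymbol]
      exact norm_laplacianCoord_le i

/-! ### Thresholds from points of the energy surface -/

theorem one_sub_sq_mul_U_cos_eq_zero {κ : ℕ} (hκ : 0 < κ) (j p : ℕ) :
    (1 - cos (p * π / κ) ^ 2) *
      (Polynomial.Chebyshev.U ℝ (((j * κ : ℕ) : ℤ) - 1)).eval (cos (p * π / κ)) = 0 := by
  rw [one_sub_sq_mul_U_cos]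
  have : ((j * κ : ℕ) : ℝ) * (p * π / κ) = (j * p : ℕ) * π := by
    have : (κ : ℝ) ≠ 0 := by exact_mod_cast hκ.ne'
    push_cast
    field_simp
  rw [this, sin_nat_mul_pi, mul_zero]

/-- At these points sin(jκ · pπ/κ) = 0 in every coordinate, so all g_{jκ} vanish and the relation
with empty right-hand side holds. -/
theorem theta0_subset_thetaM {d κ : ℕ} (hκ : 0 < κ) : theta0 d κ ⊆ ThetaM d 0 κ := by
  rintro E ⟨J, -, rfl⟩
  refine ⟨fun _ q => cos (J q * π / κ), fun _ => 0, fun q _ =>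
    ⟨fun l => ⟨neg_one_le_cos _, cos_le_one _⟩, rfl⟩, by simp, fun j _ => ?_⟩
  rw [Finset.range_zero, Finset.sum_empty, g]
  refine Finset.sum_eq_zero fun i _ => ?_
  rw [mul_assoc, one_sub_sq_mul_U_cos_eq_zero hκ, mul_zero]

theorem g_two (k : ℕ) (x y : ℝ) : g k ![x, y] =
    y * ((1 - x ^ 2) * (Polynomial.Chebyshev.U ℝ ((k : ℤ) - 1)).eval x) +
      x * ((1 - y ^ 2) * (Polynomial.Chebyshev.U ℝ ((k : ℤ) - 1)).eval y) := by
  have h0 : (Finset.univ : Finset (Fin 2)).erase 0 = {1} := by decide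
  have h1 : (Finset.univ : Finset (Fin 2)).erase 1 = {0} := by decide
  rw [g, Fin.sum_univ_two, h0, h1, Finset.prod_singleton, Finset.prod_singleton]
  simp [mul_assoc]

theorem g_three (k : ℕ) (x y z : ℝ) : g k ![x, y, z] = z * g k ![x, y] +
    x * y * ((1 - z ^ 2) * (Polynomial.Chebyshev.U ℝ ((k : ℤ) - 1)).eval z) := by
  have h0 : (Finset.univ : Finset (Fin 3)).erase 0 = {1, 2} := by decide
  have h1 : (Finset.univ : Finset (Fin 3)).erase 1 = {0, 2} := by decide
  have h2 : (Finset.univ : Finset (Fin 3)).erase 2 = {0, 1} := by decide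
  rw [g_two, g, Fin.sum_univ_three, h0, h1, h2, Finset.prod_pair (by decide),
    Finset.prod_pair (by decide), Finset.prod_pair (by decide)]
  simp
  ring

/-- The added coordinate has vanishing symbol, so it contributes no term of its own and multiplies
every g_{jκ} by the same constant. The weights ω are kept. -/
theorem mul_cos_mem_thetaM_three {m κ : ℕ} (hκ : 0 < κ) (p : ℕ) {E : ℝ}
    (hE : E ∈ ThetaM 2 m κ) : E * cos (p * π / κ) ∈ ThetaM 3 m κ := by
  obtain ⟨x, ω, hx, hω, hg⟩ := hE
  have hx2 : ∀ q, x q = ![x q 0, x q 1] := fun q => by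
    ext i
    fin_cases i <;> rfl
  have hg3 : ∀ j q, g (j * κ) ![x q 0, x q 1, cos (p * π / κ)] =
      cos (p * π / κ) * g (j * κ) (x q) := fun j q => by
    rw [g_three, one_sub_sq_mul_U_cos_eq_zero hκ, mul_zero, add_zero, ← hx2]
  refine ⟨fun q => ![x q 0, x q 1, cos (p * π / κ)], ω, fun q hq => ⟨fun l => ?_, ?_⟩, hω,
    fun j hj => ?_⟩
  · fin_cases l
    · exact (hx q hq).1 0
    · exact (hx q hq).1 1
    · exact ⟨neg_one_le_cos _, cos_le_one _⟩
  · rw [← (hx q hq).2]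
    simp [Fin.prod_univ_three, Fin.prod_univ_two]
  · simp only [hg3]
    rw [hg j hj, Finset.mul_sum]
    exact Finset.sum_congr rfl fun q _ => by ring

/-- The partial sums of a linear chain `G q = h q + h' q` with `h' (q + 1) = -r q * h q`. -/
theorem sum_prod_mul_eq {r h h' : ℕ → ℝ} (h0 : h' 0 = 0) {m : ℕ}
    (hr : ∀ q < m, h' (q + 1) = -(r q * h q)) :
    ∑ q ∈ Finset.range m, (∏ a ∈ Finset.Ico q m, r a) * (h q + h' q) = -h' m := by
  induction m with
  | zero => simp [h0]
  | succ m ih =>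
    have e : ∀ q ∈ Finset.range (m + 1), (∏ a ∈ Finset.Ico q (m + 1), r a) * (h q + h' q) =
        r m * ((∏ a ∈ Finset.Ico q m, r a) * (h q + h' q)) := fun q hq => by
      rw [Finset.prod_Ico_succ_top (Nat.lt_succ_iff.mp (Finset.mem_range.mp hq))]
      ring
    rw [Finset.sum_congr rfl e, ← Finset.mul_sum, Finset.sum_range_succ,
      ih fun q hq => hr q (hq.trans (Nat.lt_succ_self m)), Finset.Ico_self, Finset.prod_empty,
      hr m (Nat.lt_succ_self m)]
    ring

/-- The symbol at a reflected point of the circle, for frequencies divisible by four. -/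
theorem one_sub_sq_mul_U_reflect (j : ℕ) {x y : ℝ} (hx : 0 < x) (hy : 0 < y)
    (hxy : x ^ 2 + y ^ 2 = 1) :
    (1 - y ^ 2) * (Polynomial.Chebyshev.U ℝ (((j * 4 : ℕ) : ℤ) - 1)).eval y / y =
      -(x ^ 2 / y ^ 2 *
        ((1 - x ^ 2) * (Polynomial.Chebyshev.U ℝ (((j * 4 : ℕ) : ℤ) - 1)).eval x / x)) := by
  have hx1 : x ≤ 1 := by nlinarith
  obtain ⟨θ, rfl⟩ : ∃ θ, cos θ = x := ⟨arccos x, cos_arccos (by linarith) hx1⟩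
  obtain rfl : y = |sin θ| := by
    rw [← abs_of_pos hy, ← sq_eq_sq_iff_abs_eq_abs]
    linarith [sin_sq_add_cos_sq θ]
  obtain ⟨θ', hc, hs, hs0⟩ : ∃ θ', cos θ' = cos θ ∧ sin θ' = |sin θ| ∧ 0 ≤ sin θ' := by
    rcases le_total 0 (sin θ) with h | h
    · exact ⟨θ, rfl, (abs_of_nonneg h).symm, h⟩
    · exact ⟨-θ, cos_neg θ, by rw [sin_neg, abs_of_nonpos h], by rw [sin_neg]; linarith⟩
  rw [← hs, ← hc] at *
  rw [one_sub_sq_mul_U_cos, ← cos_pi_div_two_sub, one_sub_sq_mul_U_cos, sin_pi_div_two_sub,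
    cos_pi_div_two_sub]
  -- Divisibility by four enters here: the reflection θ ↦ π/2 - θ shifts the argument by a multiple
  -- of 2π and reverses its sign.
  have e : sin (((j * 4 : ℕ) : ℝ) * (π / 2 - θ')) = -sin (((j * 4 : ℕ) : ℝ) * θ') := by
    rw [show ((j * 4 : ℕ) : ℝ) * (π / 2 - θ') = j * (2 * π) - ((j * 4 : ℕ) : ℝ) * θ' by
      push_cast; ring, sin_nat_mul_two_pi_sub]
  rw [e]
  field_simp

/-- A chain of points on the unit interval, symmetric under both reflections of the
two-dimensional system, makes `E` a threshold. -/
theorem mem_thetaM_two_of_chain {N : ℕ} {E : ℝ} {X : ℕ → ℝ}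
    (hpos : ∀ q ≤ N + 1, 0 < X q) (hle : ∀ q ≤ N + 1, X q ≤ 1)
    (hmul : ∀ q ≤ N + 1, X q * X (N + 1 - q) = E)
    (hsq : ∀ q ≤ N, X q ^ 2 + X (N - q) ^ 2 = 1) (hend : X (N + 1) = 1) :
    E ∈ ThetaM 2 ((N + 1) / 2) 4 := by
  obtain ⟨m, hm⟩ : ∃ m, (N + 1) / 2 = m := ⟨_, rfl⟩
  rw [hm]
  have hmN : m ≤ N := by omega
  have hEpos : 0 < E := by
    rw [← hmul 0 (by omega)]
    exact mul_pos (hpos _ (by omega)) (hpos _ (by omega))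
  obtain ⟨r, hr⟩ : ∃ r : ℕ → ℝ, r = fun q => X q ^ 2 / X (N - q) ^ 2 := ⟨_, rfl⟩
  have hr0 : ∀ q, 0 ≤ r q := fun q => by rw [hr]; positivity
  -- Dividing by X_q and using X_q X_{N+1-q} = E separates g into one term for each coordinate.
  obtain ⟨h, hh⟩ : ∃ h : ℕ → ℕ → ℝ, h = fun j q => E * ((1 - X q ^ 2) *
    (Polynomial.Chebyshev.U ℝ (((j * 4 : ℕ) : ℤ) - 1)).eval (X q) / X q) := ⟨_, rfl⟩
  have hg : ∀ j, ∀ q ≤ N + 1, g (j * 4) ![X q, X (N + 1 - q)] = h j q + h j (N + 1 - q) := by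
    intro j q hq
    have h1 := (hpos q hq).ne'
    have h2 := (hpos (N + 1 - q) (by omega)).ne'
    rw [g_two, hh, ← hmul q hq]
    field_simp
  have hrefl : ∀ j, ∀ q ≤ N, h j (N - q) = -(r q * h j q) := by
    intro j q hq
    rw [hh, hr]
    simp only
    rw [one_sub_sq_mul_U_reflect j (hpos q (by omega)) (hpos (N - q) (by omega)) (hsq q hq)]
    ring
  have hh0 : ∀ j, h j (N + 1) = 0 := fun j => by
    rw [hh]
    simp [hend]
  -- The second term at q + 1 is -r_q times the first term at q, so the weighted sum telescopes; it
  -- starts from 0 because X_{N+1} = 1.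
  have hsum : ∀ j, ∑ q ∈ Finset.range m, (∏ a ∈ Finset.Ico q m, r a) *
      g (j * 4) ![X q, X (N + 1 - q)] = -h j (N + 1 - m) := by
    intro j
    rw [← sum_prod_mul_eq (r := r) (h := h j) (h' := fun q => h j (N + 1 - q)) (by simp [hh0])
      fun q hq => ?_]
    · refine Finset.sum_congr rfl fun q hq => ?_
      rw [hg j q (by have := Finset.mem_range.mp hq; omega)]
    · rw [← hrefl j q (by omega)]
      congr 1
      omega
  -- The middle of the chain closes the relation. For even N the midpoint is fixed by the circle
  -- reflection, its term is its own negative multiple and vanishes, and μ = 1. For odd N the last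
  -- point has equal coordinates, and μ = 2.
  obtain ⟨μ, hμ0, hμ⟩ : ∃ μ : ℝ, 0 ≤ μ ∧
      ∀ j, g (j * 4) ![X m, X (N + 1 - m)] = μ * h j (N + 1 - m) := by
    rcases Nat.even_or_odd' N with ⟨p, hp | hp⟩
    · refine ⟨1, zero_le_one, fun j => ?_⟩
      have hrm : 0 ≤ r m := hr0 m
      have h1 := hrefl j m hmN
      rw [show N - m = m by omega] at h1
      have h2 : h j m = 0 := by
        have : (1 + r m) * h j m = 0 := by linarith
        exact (mul_eq_zero.mp this).resolve_left (by linarith)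
      rw [hg j m (by omega), h2, zero_add, one_mul]
    · refine ⟨2, zero_le_two, fun j => ?_⟩
      rw [hg j m (by omega), show N + 1 - m = m by omega]
      ring
  refine ⟨fun q => ![X q, X (N + 1 - q)], fun q => -(μ * ∏ a ∈ Finset.Ico q m, r a),
    fun q hq => ⟨fun l => ?_, ?_⟩, fun q _ => ?_, fun j _ => ?_⟩
  · fin_cases l
    · exact ⟨by have := hpos q (by omega); simp; linarith, hle q (by omega)⟩
    · exact ⟨by have := hpos (N + 1 - q) (by omega); simp; linarith, hle _ (by omega)⟩
  · simpa [Fin.prod_univ_two] using hmul q (by omega)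
  · exact neg_nonpos.mpr (mul_nonneg hμ0 (Finset.prod_nonneg fun a _ => hr0 a))
  · have e := congrArg (fun t => -μ * t) (hsum j)
    simp only [Finset.mul_sum, neg_mul_neg] at e
    rw [hμ j, ← e]
    exact Finset.sum_congr rfl fun q _ => by ring

/-! ### The explicit sequence of energies -/

theorem cos_pi_div_four_pos : 0 < cos (π / 4) := by rw [cos_pi_div_four]; positivity

theorem two_mul_cos_pi_div_four_sq : 2 * cos (π / 4) ^ 2 = 1 := by
  rw [cos_pi_div_four, div_pow, Real.sq_sqrt zero_le_two]
  norm_num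

/-- The angle `π / (n + 4)`. -/
noncomputable def angle (n : ℕ) : ℝ := π / (n + 4)

/-- The `n`-th energy `1 / (2 cos (π / (n + 4)))`. -/
noncomputable def energy (n : ℕ) : ℝ := 1 / (2 * cos (angle n))

theorem angle_pos (n : ℕ) : 0 < angle n := by unfold angle; positivity

theorem angle_mul (n : ℕ) : (n + 4) * angle n = π := by
  unfold angle
  field_simp

theorem strictAnti_angle : StrictAnti angle := fun m n h => by
  unfold angle
  have : (m : ℝ) < n := by exact_mod_cast h
  gcongr

theorem angle_zero : angle 0 = π / 4 := by simp [angle]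

theorem angle_le (n : ℕ) : angle n ≤ π / 4 := angle_zero ▸ strictAnti_angle.antitone n.zero_le

theorem cos_angle_pos (n : ℕ) : 0 < cos (angle n) :=
  cos_pos_of_mem_Ioo ⟨by linarith [angle_pos n, pi_pos], by linarith [angle_le n, pi_pos]⟩

theorem energy_pos (n : ℕ) : 0 < energy n := by
  have := cos_angle_pos n
  unfold energy
  positivity

theorem two_mul_cos_mul_energy (n : ℕ) : 2 * cos (angle n) * energy n = 1 := by
  have := (cos_angle_pos n).ne'
  unfold energy
  field_simp

theorem strictAnti_energy : StrictAnti energy := fun m n h => by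
  have h1 : cos (angle m) < cos (angle n) :=
    cos_lt_cos_of_nonneg_of_le_pi (angle_pos n).le (by linarith [angle_le m, pi_pos])
      (strictAnti_angle h)
  have := cos_angle_pos m
  unfold energy
  gcongr

theorem energy_zero : energy 0 = cos (π / 4) := by
  have h := two_mul_cos_mul_energy 0
  rw [angle_zero] at h
  refine mul_left_cancel₀ cos_pi_div_four_pos.ne' ?_
  linarith [two_mul_cos_pi_div_four_sq]

theorem half_lt_energy (n : ℕ) : 1 / 2 < energy n := by
  have h := two_mul_cos_mul_energy n
  have h1 : cos (angle n) < 1 := by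
    rw [← cos_zero]
    exact cos_lt_cos_of_nonneg_of_le_pi le_rfl (by linarith [angle_le n, pi_pos]) (angle_pos n)
  nlinarith [energy_pos n]

theorem energy_mem_Ioo {n : ℕ} (hn : 1 ≤ n) :
    energy n ∈ Ioo (cos (π / 4) ^ 2) (cos (π / 4)) :=
  ⟨by linarith [half_lt_energy n, two_mul_cos_pi_div_four_sq],
    energy_zero ▸ strictAnti_energy (Nat.lt_of_lt_of_le Nat.zero_lt_one hn)⟩

theorem tendsto_energy : Tendsto energy atTop (𝓝 (cos (π / 4) ^ 2)) := by
  have h1 : Tendsto angle atTop (𝓝 0) :=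
    tendsto_const_nhds.div_atTop
      (tendsto_atTop_add_const_right _ _ tendsto_natCast_atTop_atTop)
  have h2 := ((continuous_cos.tendsto 0).comp h1).const_mul 2
  have h3 := (tendsto_const_nhds (x := (1 : ℝ))).div h2 (by simp)
  rw [cos_zero] at h3
  rw [show cos (π / 4) ^ 2 = 1 / (2 * 1) by linarith [two_mul_cos_pi_div_four_sq]]
  exact h3

/-! ### Trigonometric solution of the n-th system. -/

/-- `sin (k π / (n + 4))`. -/
noncomputable def sinSeq (n k : ℕ) : ℝ := sin (k * angle n)

theorem sinSeq_pos {n k : ℕ} (hk : 0 < k) (hkn : k ≤ n + 3) : 0 < sinSeq n k := by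
  have hk' : (0 : ℝ) < k := by exact_mod_cast hk
  refine sin_pos_of_pos_of_lt_pi (mul_pos hk' (angle_pos n)) ?_
  rw [← angle_mul n]
  have : (k : ℝ) ≤ n + 3 := by exact_mod_cast hkn
  exact mul_lt_mul_of_pos_right (by linarith) (angle_pos n)

theorem sinSeq_symm {n k l : ℕ} (h : k + l = n + 4) : sinSeq n k = sinSeq n l := by
  have h' : (k : ℝ) + l = n + 4 := by exact_mod_cast h
  rw [sinSeq, sinSeq, ← sin_pi_sub]
  congr 1
  linear_combination -angle_mul n - angle n * h'

theorem sin_mul_add_sin_mul (k : ℕ) (φ : ℝ) :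
    sin ((k : ℕ) * φ) + sin ((k + 2 : ℕ) * φ) = 2 * cos φ * sin ((k + 1 : ℕ) * φ) := by
  push_cast
  rw [show (k : ℝ) * φ = (k + 1) * φ - φ by ring, show ((k : ℝ) + 2) * φ = (k + 1) * φ + φ by ring,
    sin_sub, sin_add]
  ring

theorem sinSeq_sq_sub (n k : ℕ) :
    sinSeq n (k + 1) ^ 2 - sinSeq n k * sinSeq n (k + 2) = sin (angle n) ^ 2 := by
  unfold sinSeq
  push_cast
  set φ := angle n
  rw [show (k : ℝ) * φ = (k + 1) * φ - φ by ring, show ((k : ℝ) + 2) * φ = (k + 1) * φ + φ by ring,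
    sin_sub, sin_add]
  linear_combination (sin φ ^ 2) * sin_sq_add_cos_sq ((k + 1) * φ) -
    sin ((k + 1) * φ) ^ 2 * sin_sq_add_cos_sq φ

/-- The squares of the points of the `n`-th two-dimensional system. -/
noncomputable def chainSq (n q : ℕ) : ℝ := energy n * (sinSeq n (q + 1) / sinSeq n (q + 2))

theorem chainSq_pos {n q : ℕ} (hq : q ≤ n + 1) : 0 < chainSq n q :=
  mul_pos (energy_pos n) (div_pos (sinSeq_pos (by omega) (by omega))
    (sinSeq_pos (by omega) (by omega)))

theorem chainSq_mul {n q : ℕ} (hq : q ≤ n + 1) :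
    chainSq n q * chainSq n (n + 1 - q) = energy n ^ 2 := by
  have h1 := (sinSeq_pos (n := n) (k := q + 1) (by omega) (by omega)).ne'
  have h2 := (sinSeq_pos (n := n) (k := q + 2) (by omega) (by omega)).ne'
  unfold chainSq
  rw [sinSeq_symm (n := n) (k := n + 1 - q + 1) (l := q + 2) (by omega),
    sinSeq_symm (n := n) (k := n + 1 - q + 2) (l := q + 1) (by omega)]
  field_simp

/-- The symmetry k ↦ n + 4 - k gives both fractions the denominator s_{q+2}, and s_{q+1} + s_{q+3} =
2 cos φ s_{q+2} cancels against 2 E cos φ = 1. -/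
theorem chainSq_add {n q : ℕ} (hq : q ≤ n) : chainSq n q + chainSq n (n - q) = 1 := by
  have h2 := (sinSeq_pos (n := n) (k := q + 2) (by omega) (by omega)).ne'
  have h := sin_mul_add_sin_mul (q + 1) (angle n)
  have h' : sinSeq n (q + 1) + sinSeq n (q + 3) = 2 * cos (angle n) * sinSeq n (q + 2) := h
  unfold chainSq
  rw [sinSeq_symm (n := n) (k := n - q + 1) (l := q + 3) (by omega),
    sinSeq_symm (n := n) (k := n - q + 2) (l := q + 2) (by omega), ← mul_add, ← add_div, h',
    mul_div_assoc, div_self h2, mul_one, mul_comm, two_mul_cos_mul_energy]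

theorem chainSq_last (n : ℕ) : chainSq n (n + 1) = 1 := by
  have h1 := (sinSeq_pos (n := n) (k := 1) (by omega) (by omega)).ne'
  have h := sin_mul_add_sin_mul 0 (angle n)
  have h' : sinSeq n 0 + sinSeq n 2 = 2 * cos (angle n) * sinSeq n 1 := h
  have h0 : sinSeq n 0 = 0 := by simp [sinSeq]
  rw [h0, zero_add] at h'
  unfold chainSq
  rw [sinSeq_symm (n := n) (k := n + 1 + 1) (l := 2) (by omega),
    sinSeq_symm (n := n) (k := n + 1 + 2) (l := 1) (by omega), h', mul_div_assoc, div_self h1,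
    mul_one, mul_comm, two_mul_cos_mul_energy]

theorem chainSq_zero (n : ℕ) : chainSq n 0 = energy n ^ 2 := by
  have := chainSq_mul (n := n) (q := 0) (by omega)
  rwa [Nat.sub_zero, chainSq_last, mul_one] at this

/-- Strict log-concavity of the sines: s_{k+1}² - s_k s_{k+2} = sin²φ > 0. -/
theorem chainSq_lt {n q : ℕ} (hq : q ≤ n) : chainSq n q < chainSq n (q + 1) := by
  have h2 := sinSeq_pos (n := n) (k := q + 2) (by omega) (by omega)
  have h3 := sinSeq_pos (n := n) (k := q + 3) (by omega) (by omega)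
  have hs : 0 < sin (angle n) := sin_pos_of_pos_of_lt_pi (angle_pos n)
    (by linarith [angle_le n, pi_pos])
  have h := sinSeq_sq_sub n (q + 1)
  unfold chainSq
  refine mul_lt_mul_of_pos_left ?_ (energy_pos n)
  rw [div_lt_div_iff₀ h2 h3]
  have : 0 < sin (angle n) ^ 2 := by positivity
  linarith

theorem chainSq_lt_of_lt {n p q : ℕ} (hpq : p < q) (hq : q ≤ n + 1) :
    chainSq n p < chainSq n q := by
  induction q, hpq using Nat.le_induction with
  | base => exact chainSq_lt (by omega)
  | succ q hpq ih => exact (ih (by omega)).trans (chainSq_lt (by omega))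

theorem chainSq_le_one {n q : ℕ} (hq : q ≤ n + 1) : chainSq n q ≤ 1 := by
  rcases hq.eq_or_lt with rfl | h
  · exact (chainSq_last n).le
  · exact (chainSq_last n ▸ chainSq_lt_of_lt h le_rfl).le

/-- The points of the `n`-th two-dimensional system. -/
noncomputable def chain (n q : ℕ) : ℝ := √(chainSq n q)

theorem chain_pos {n q : ℕ} (hq : q ≤ n + 1) : 0 < chain n q := Real.sqrt_pos.mpr (chainSq_pos hq)

theorem chain_sq {n q : ℕ} (hq : q ≤ n + 1) : chain n q ^ 2 = chainSq n q :=
  Real.sq_sqrt (chainSq_pos hq).le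

theorem chain_mul {n q : ℕ} (hq : q ≤ n + 1) : chain n q * chain n (n + 1 - q) = energy n := by
  rw [chain, chain, ← Real.sqrt_mul (chainSq_pos hq).le, chainSq_mul hq,
    Real.sqrt_sq (energy_pos n).le]

theorem chain_last (n : ℕ) : chain n (n + 1) = 1 := by rw [chain, chainSq_last, Real.sqrt_one]

theorem energy_mem_thetaM_two (n : ℕ) : energy n ∈ ThetaM 2 ((n + 1) / 2) 4 := by
  refine mem_thetaM_two_of_chain (X := chain n) (fun q hq => chain_pos hq) (fun q hq => ?_)
    (fun q hq => chain_mul hq) (fun q hq => ?_) (chain_last n)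
  · exact Real.sqrt_le_one.mpr (chainSq_le_one hq)
  · rw [chain_sq (by omega), chain_sq (by omega), chainSq_add hq]

theorem eval_T_four (x : ℝ) :
    (Polynomial.Chebyshev.T ℝ ((4 : ℕ) : ℤ)).eval x = 2 * (2 * x ^ 2 - 1) ^ 2 - 1 := by
  have h : (((4 : ℕ) : ℤ)) = 2 * 2 := rfl
  rw [h, Polynomial.Chebyshev.T_mul, Polynomial.eval_comp, Polynomial.Chebyshev.T_two]
  simp

theorem isEnergy_energy {n : ℕ} (hn : 1 ≤ n) : IsEnergy 4 n (energy n) := by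
  refine ⟨by simpa using energy_mem_Ioo hn, chain n, fun q hq => ?_, fun q hq => ?_, ?_,
    chain_last n, fun q hq => ?_, fun hodd => ?_, fun heven => ?_⟩
  · rw [eval_T_four, eval_T_four, chain_sq (by omega), chain_sq (by omega)]
    have := chainSq_add (n := n) (q := q) (by omega)
    rw [← eq_sub_iff_add_eq'] at this
    rw [this]
    ring
  · rw [eq_div_iff (chain_pos (by omega)).ne', mul_comm, chain_mul (by omega)]
  · rw [chain, chainSq_zero, Real.sqrt_sq (energy_pos n).le]
  · exact Real.sqrt_lt_sqrt (chainSq_pos (by omega)).le (chainSq_lt hq)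
  · obtain ⟨m, rfl⟩ := hodd
    have h1 := chainSq_add (n := 2 * m + 1) (q := m) (by omega)
    have h2 := chainSq_lt (n := 2 * m + 1) (q := m) (by omega)
    rw [show 2 * m + 1 - m = m + 1 by omega] at h1
    rw [show (2 * m + 1 - 1) / 2 = m by omega, show (2 * m + 1 + 1) / 2 = m + 1 by omega]
    push_cast
    have hc := two_mul_cos_pi_div_four_sq
    refine ⟨(Real.sqrt_lt' cos_pi_div_four_pos).mpr (by linarith),
      (Real.lt_sqrt cos_pi_div_four_pos.le).mpr (by linarith)⟩
  · obtain ⟨m, rfl⟩ := heven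
    have h1 := chainSq_add (n := m + m) (q := m) (by omega)
    rw [Nat.add_sub_cancel] at h1
    rw [show (m + m) / 2 = m by omega, chain]
    push_cast
    rw [show chainSq (m + m) m = cos (π / 4) ^ 2 by linarith [two_mul_cos_pi_div_four_sq],
      Real.sqrt_sq cos_pi_div_four_pos.le]

/-- Any solution obeys the Möbius recursion for Y_q = X_q², hence the sine formula with 2 e cos φ =
1. The end condition and positivity then determine φ. -/
theorem eq_energy_of_isEnergy {n : ℕ} {e : ℝ} (h : IsEnergy 4 n e) : e = energy n := by
  obtain ⟨⟨he1, he2⟩, X, hT, hmul, h0, h1, hlt, -, heven⟩ := h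
  push_cast at he1 he2 heven
  have hc := two_mul_cos_pi_div_four_sq
  have hcpos := cos_pi_div_four_pos
  have he0 : 0 < e := lt_of_le_of_lt (by positivity) he1
  have hmono : ∀ p q, p < q → q ≤ n + 1 → X p < X q := by
    intro p q hpq hq
    induction q, hpq using Nat.le_induction with
    | base => exact hlt p (by omega)
    | succ q hpq ih => exact (ih (by omega)).trans (hlt q (by omega))
  have hpos : ∀ q ≤ n + 1, 0 < X q := by
    intro q hq
    rcases Nat.eq_zero_or_pos q with rfl | h
    · rwa [h0]
    · exact (h0 ▸ he0).trans (hmono 0 q h hq)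
  -- T_4(x) - T_4(y) = 8(x² - y²)(x² + y² - 1), and strict monotonicity of X excludes the first
  -- factor.
  have hadd' : ∀ q, 2 * q < n → X q ^ 2 + X (n - q) ^ 2 = 1 := by
    intro q hq
    have h2 := hT q hq
    rw [eval_T_four, eval_T_four] at h2
    have h3 := hmono q (n - q) (by omega) (by omega)
    have h4 := hpos q (by omega)
    have h5 : X (n - q) ^ 2 - X q ^ 2 ≠ 0 := by
      have : 0 < X (n - q) ^ 2 - X q ^ 2 := by nlinarith
      exact this.ne'
    refine mul_left_cancel₀ h5 ?_
    linear_combination -h2 / 8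
  have hadd : ∀ q ≤ n, X q ^ 2 + X (n - q) ^ 2 = 1 := by
    intro q hq
    -- The Chebyshev equations say nothing at q = n/2; there the prescribed value cos(π/4) supplies
    -- the equation.
    rcases lt_trichotomy (2 * q) n with h | h | h
    · exact hadd' q h
    · have h2 := heven ⟨q, by omega⟩
      rw [show n / 2 = q by omega] at h2
      rw [show n - q = q by omega, h2]
      linarith
    · have := hadd' (n - q) (by omega)
      rw [Nat.sub_sub_self hq] at this
      linarith
  have hmul' : ∀ q ≤ n + 1, X q * X (n + 1 - q) = e := by
    intro q hq
    rcases le_total (2 * q) (n + 1) with h | h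
    · rw [hmul q h, mul_div_cancel₀ _ (hpos q hq).ne']
    · have := hmul (n + 1 - q) (by omega)
      rw [Nat.sub_sub_self hq] at this
      rw [this, div_mul_cancel₀ _ (hpos (n + 1 - q) (by omega)).ne']
  obtain ⟨φ, hφ⟩ : ∃ φ, φ = arccos (1 / (2 * e)) := ⟨_, rfl⟩
  have hlt1 : 1 / (2 * e) < 1 := by
    rw [div_lt_one (by positivity)]
    linarith
  have hgt : cos (π / 4) < 1 / (2 * e) := by
    rw [lt_div_iff₀ (by positivity)]
    nlinarith
  have hcos : cos φ = 1 / (2 * e) := by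
    rw [hφ, cos_arccos (by linarith) hlt1.le]
  have hcose : 2 * cos φ * e = 1 := by
    rw [hcos]
    field_simp
  have hφ0 : 0 < φ := by rw [hφ]; exact arccos_pos.mpr hlt1
  have hφ1 : φ < π := by
    rw [hφ]
    refine lt_of_le_of_ne (arccos_le_pi _) fun hh => ?_
    rw [arccos_eq_pi] at hh
    linarith
  -- Positivity of the sines is part of the induction: the next sine is a positive multiple of
  -- X_{n-q}² times the present one.
  have key : ∀ q ≤ n + 1, 0 < sin ((q + 2 : ℕ) * φ) ∧
      X q ^ 2 * sin ((q + 2 : ℕ) * φ) = e * sin ((q + 1 : ℕ) * φ) := by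
    intro q
    induction q with
    | zero =>
      intro _
      have hs : 0 < sin φ := sin_pos_of_pos_of_lt_pi hφ0 hφ1
      have hcp : 0 < cos φ := by rw [hcos]; positivity
      have e2 : sin ((0 + 2 : ℕ) * φ) = 2 * sin φ * cos φ := by
        rw [← sin_two_mul]
        norm_num
      have e1 : sin ((0 + 1 : ℕ) * φ) = sin φ := by simp
      rw [e2, e1, h0]
      refine ⟨by positivity, ?_⟩
      linear_combination e * sin φ * hcose
    | succ q ih =>
      intro hq
      obtain ⟨hs, hX⟩ := ih (by omega)
      have hrec := sin_mul_add_sin_mul (q + 1) φ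
      have h2 := hadd q (by omega)
      have h3 := hmul' (q + 1) hq
      rw [Nat.add_sub_add_right] at h3
      have h4 := hpos (n - q) (by omega)
      have h5 : X (n - q) ^ 2 * sin ((q + 2 : ℕ) * φ) = e * sin ((q + 3 : ℕ) * φ) := by
        linear_combination sin ((q + 2 : ℕ) * φ) * h2 - hX - e * hrec -
          sin ((q + 2 : ℕ) * φ) * hcose
      have h6 : 0 < sin ((q + 3 : ℕ) * φ) := by
        have : 0 < e * sin ((q + 3 : ℕ) * φ) := by rw [← h5]; positivity
        exact pos_of_mul_pos_right this he0.le
      refine ⟨h6, mul_left_cancel₀ he0.ne' ?_⟩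
      change e * (X (q + 1) ^ 2 * sin ((q + 3 : ℕ) * φ)) = e * (e * sin ((q + 2 : ℕ) * φ))
      linear_combination -X (q + 1) ^ 2 * h5 +
        sin ((q + 2 : ℕ) * φ) * (X (q + 1) * X (n - q) + e) * h3
  have hlast : sin ((n + 4 : ℕ) * φ) = 0 := by
    have h2 := (key (n + 1) le_rfl).2
    rw [h1] at h2
    have hrec := sin_mul_add_sin_mul (n + 2) φ
    refine mul_left_cancel₀ he0.ne' ?_
    change 1 ^ 2 * sin ((n + 3 : ℕ) * φ) = e * sin ((n + 2 : ℕ) * φ) at h2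
    linear_combination e * hrec + h2 + sin ((n + 3 : ℕ) * φ) * hcose
  -- The multiples of φ advance by less than π, so the first one to reach π would have nonpositive
  -- sine, contrary to `key`.
  have hkey : ∀ k ≤ n + 3, (k : ℝ) * φ < π := by
    intro k
    induction k with
    | zero => intro _; simpa using pi_pos
    | succ k ih =>
      intro hk
      have h2 := ih (by omega)
      rcases Nat.eq_zero_or_pos k with rfl | hk0
      · simpa using hφ1
      have h3 := (key (k - 1) (by omega)).1
      rw [show k - 1 + 2 = k + 1 by omega] at h3
      by_contra! hcon
      have : sin ((k + 1 : ℕ) * φ) ≤ 0 := by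
        rw [← neg_nonneg, ← sin_sub_pi]
        refine sin_nonneg_of_nonneg_of_le_pi (by linarith) ?_
        push_cast
        linarith
      linarith
  -- Since (n+3)φ < π, the zero of the sine at (n+4)φ lies in (0, 2π), so it must be π.
  have hpi : ((n + 4 : ℕ) : ℝ) * φ = π := by
    have h2 := hkey (n + 3) le_rfl
    have h3 : ((n + 4 : ℕ) : ℝ) * φ = ((n + 3 : ℕ) : ℝ) * φ + φ := by push_cast; ring
    have h4 : sin (((n + 4 : ℕ) : ℝ) * φ - π) = 0 := by rw [sin_sub_pi, hlast, neg_zero]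
    have h5 : 0 < ((n + 4 : ℕ) : ℝ) * φ := by positivity
    have h6 := (sin_eq_zero_iff_of_lt_of_lt (by linarith) (by linarith)).mp h4
    linarith
  have hang : φ = angle n := by
    rw [angle, eq_div_iff (by positivity)]
    push_cast at hpi
    linarith
  rw [energy, ← hang, hcos]
  field_simp

theorem isEnergySeq_energy : IsEnergySeq 4 energy :=
  ⟨by simpa using energy_zero, fun _ hn _ =>
    ⟨eq_energy_of_isEnergy, fun h => h ▸ isEnergy_energy hn⟩⟩

end MV

theorem theorem1 :
    Ioo (cos (π / 4)) 1 ⊆ MV.mu 3 4 ∧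
    ({0, cos (π / 4) ^ 3, cos (π / 4) ^ 2, cos (π / 4), 1} : Set ℝ) ⊆ MV.theta0 3 4 ∧
    MV.theta0 3 4 ⊆ MV.ThetaM 3 0 4 ∧
    ∃ E : ℕ → ℝ, MV.IsEnergySeq 4 E ∧
      -- the two-dimensional facts about the sequence
      ((∀ n, E n ∈ MV.Theta 2 4) ∧
        ∀ n, 1 ≤ n → E (2 * n - 1) ∈ MV.ThetaM 2 n 4 ∧ E (2 * n) ∈ MV.ThetaM 2 n 4) ∧
      -- the three-dimensional facts
      ((∀ n, E n ∈ MV.Theta 3 4) ∧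
        (∀ n, 1 ≤ n → E n ∈ Ioo (cos (π / 4) ^ 2) (cos (π / 4))) ∧
        StrictAnti E ∧ Tendsto E atTop (𝓝 (cos (π / 4) ^ 2))) ∧
      ((∀ n, E n * cos (π / 4) ∈ MV.Theta 3 4) ∧
        (∀ n, 1 ≤ n → E n * cos (π / 4) ∈ Ioo (cos (π / 4) ^ 3) (cos (π / 4) ^ 2)) ∧
        StrictAnti (fun n => E n * cos (π / 4)) ∧
        Tendsto (fun n => E n * cos (π / 4)) atTop (𝓝 (cos (π / 4) ^ 3))) := by
  have hc := MV.cos_pi_div_four_pos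
  have hcube : cos (π / 4) ^ 3 = cos (π / 4) ^ 2 * cos (π / 4) := pow_succ _ 2
  have h0 : ((0 : ℕ) : ℝ) * π / (4 : ℕ) = 0 := by simp
  have h1 : ((1 : ℕ) : ℝ) * π / (4 : ℕ) = π / 4 := by simp
  have h2 : ((2 : ℕ) : ℝ) * π / (4 : ℕ) = π / 2 := by push_cast; ring
  have hmem : ∀ a b c : ℕ, a ≤ 4 → b ≤ 4 → c ≤ 4 → cos (a * π / (4 : ℕ)) *
      cos (b * π / (4 : ℕ)) * cos (c * π / (4 : ℕ)) ∈ MV.theta0 3 4 := by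
    intro a b c ha hb hc
    refine ⟨![a, b, c], fun q => ?_, ?_⟩
    · fin_cases q
      · exact ha
      · exact hb
      · exact hc
    · simp [Fin.prod_univ_three]
  refine ⟨MV.Ioo_subset_mu, ?_, MV.theta0_subset_thetaM (by norm_num), MV.energy,
    MV.isEnergySeq_energy, ⟨fun n => ?_, fun n hn => ⟨?_, ?_⟩⟩,
    ⟨fun n => ?_, fun n hn => MV.energy_mem_Ioo hn, MV.strictAnti_energy, MV.tendsto_energy⟩,
    ⟨fun n => ?_, fun n hn => ⟨?_, ?_⟩, fun m n h => ?_, ?_⟩⟩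
  · rintro E (rfl | rfl | rfl | rfl | rfl)
    · have := hmem 2 0 0 (by norm_num) (by norm_num) (by norm_num)
      rwa [h2, cos_pi_div_two, zero_mul, zero_mul] at this
    · have := hmem 1 1 1 (by norm_num) (by norm_num) (by norm_num)
      rwa [h1, ← sq, ← hcube] at this
    · have := hmem 1 1 0 (by norm_num) (by norm_num) (by norm_num)
      rwa [h1, h0, cos_zero, mul_one, ← sq] at this
    · have := hmem 1 0 0 (by norm_num) (by norm_num) (by norm_num)
      rwa [h1, h0, cos_zero, mul_one, mul_one] at this
    · have := hmem 0 0 0 (by norm_num) (by norm_num) (by norm_num)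
      rwa [h0, cos_zero, mul_one, mul_one] at this
  · exact MV.thetaM_subset_theta (by norm_num) (by norm_num) _ (MV.energy_mem_thetaM_two n)
  · have := MV.energy_mem_thetaM_two (2 * n - 1)
    rwa [show (2 * n - 1 + 1) / 2 = n by omega] at this
  · have := MV.energy_mem_thetaM_two (2 * n)
    rwa [show (2 * n + 1) / 2 = n by omega] at this
  -- The factors cos 0 = 1 and cos(π/4) give the two three-dimensional families.
  · have := MV.mul_cos_mem_thetaM_three (by norm_num) 0 (MV.energy_mem_thetaM_two n)
    rw [h0, cos_zero, mul_one] at this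
    exact MV.thetaM_subset_theta (by norm_num) (by norm_num) _ this
  · have := MV.mul_cos_mem_thetaM_three (by norm_num) 1 (MV.energy_mem_thetaM_two n)
    rw [h1] at this
    exact MV.thetaM_subset_theta (by norm_num) (by norm_num) _ this
  · rw [hcube]
    exact mul_lt_mul_of_pos_right (MV.energy_mem_Ioo hn).1 hc
  · rw [sq]
    exact mul_lt_mul_of_pos_right (MV.energy_mem_Ioo hn).2 hc
  · exact mul_lt_mul_of_pos_right (MV.strictAnti_energy h) hc
  · rw [hcube]
    exact MV.tendsto_energy.mul_const _
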